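/- Let $G$ be a finite 3-group with $|G:G'| = 9$ and $|G| \ge 81$. Write $\gamma_1(G)=G$, $\gamma_{i+1}(G)=[\gamma_i(G),G]$ for the terms of the lower central series, and let $G^3$ be the subgroup generated by all cubes $g^3$, $g\in G$. Then: (1) $G^3 = \gamma_3(G)$, and this subgroup has index $27$ in $G$. (2) Every maximal subgroup of $G$ can be generated by at most $3$ elements. (3) Some maximal subgroup of $G$ is metacyclic (that is, has a cyclic normal subgroup with cyclic quotient), or some maximal subgroup $H$ of $G$ satisfies $|H:H'| \le 27$ (possibly both). (4) If $|G:\gamma_4(G)| = 3^4$, then $G$ is of maximal class, that is, $|G| = 3^n$ with $n \ge 3$ and $G$ is nilpotent of class $n-1$. -/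

import Mathlib

/-- `γ_n(G)`, the `n`-th term of the lower central series in the usual numbering from `1`:
`γ_1(G) = G`, `γ_{n+1}(G) = [γ_n(G), G]` (with `γ_0(G) = G` as a dummy value). -/
def gammaSubgroup (G : Type*) [Group G] (n : ℕ) : Subgroup G :=
  (⊤ : Subgroup G).lowerCentralSeries (n - 1)

/-- `G^n`, the subgroup generated by all `n`-th powers of elements of `G`. -/
def powerSubgroup (G : Type*) [Group G] (n : ℕ) : Subgroup G :=
  Subgroup.closure (Set.range fun g : G => g ^ n)

/-- A group is metacyclic if it has a cyclic normal subgroup with cyclic quotient. -/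
def IsMetacyclic (G : Type*) [Group G] : Prop :=
  ∃ (N : Subgroup G) (_ : N.Normal), IsCyclic N ∧ IsCyclic (G ⧸ N)

/-- A group of order `p ^ n` with `n ≥ 3` is of maximal class if it is nilpotent of
class `n - 1`. -/
def IsOfMaximalClass (p : ℕ) (G : Type*) [Group G] : Prop :=
  ∃ n : ℕ, 3 ≤ n ∧ Nat.card G = p ^ n ∧ Group.IsNilpotent G ∧ Group.nilpotencyClass G = n - 1

/-!
A nonabelian `G` is generated by two elements `h`, `g`, its maximal subgroups are the `⟨h⟩G'`, and
each quotient `γ_i / γ_{i+1}` can be studied on commutators in `h` and `g`. Groups of exponent `3`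
are 2-Engel, so `γ_3 ≤ G ^ 3`; conversely a cube outside `γ_3` would generate `γ_2` modulo `γ_3`
and commute modulo `γ_4` with both generators, forcing `γ_3 = ⊥`.

For (3), put `H = ⟨h⟩G'`. Then `|H : H'| = 9 |γ_3 : H'|`, which is at most `27` as soon as
`γ_4 ≤ H'`. If this fails for every `h`, then `h ^ 3 ≡ ⁅g, ⁅g, h⁆⁆⁻¹` modulo `⟨⁅h, ⁅g, h⁆⁆⟩γ_4` for
all generating pairs. In the class 3 group `G / γ_4` these relations, applied to `(x, y)`, `(y, x)`,
`(yx, y)` and `(y⁻¹x, y⁻¹)`, show that `⁅g, ⁅g, h⁆⁆ ∈ ⟨⁅h, ⁅g, h⁆⁆⟩γ_4` for one of the pairs, and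
then even `γ_3 ≤ H'`.

For (4), choose generators `a`, `s` with `a` centralizing `γ_2 / γ_4`. Unless `γ_4 = ⊥`, one gets
`s ^ 3 ∈ γ_4`. The commutators `e_k = ⁅s, …, ⁅s, a⁆⁆` then satisfy `e_{k+2} ≡ e_k⁻³` modulo
`γ_{k+4}`, by which `a` centralizes every `γ_i / γ_{i+2}`, so that `e_k` generates `γ_{k+1}` modulo
`γ_{k+2}` and all these quotients have order dividing `3`.
-/

open Subgroup
open scoped commutatorElement

section CommutatorsModulo

variable {G : Type*} [Group G]

theorem commute_mk_iff {N : Subgroup G} [N.Normal] {a b : G} :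
    Commute (a : G ⧸ N) (b : G ⧸ N) ↔ ⁅a, b⁆ ∈ N := by
  rw [← commutatorElement_eq_one_iff_commute, ← QuotientGroup.eq_one_iff]
  rfl

theorem commutatorElement_mem_comm {N : Subgroup G} {a b : G} : ⁅a, b⁆ ∈ N ↔ ⁅b, a⁆ ∈ N := by
  rw [← commutatorElement_inv, inv_mem_iff]

theorem commutatorElement_zpow_right {a b : G} (h : Commute ⁅a, b⁆ b) (k : ℤ) :
    ⁅a, b ^ k⁆ = ⁅a, b⁆ ^ k := by
  rw [commutatorElement_def, ← conj_zpow, ← MulAut.conj_apply, conj_eq_commutatorElement_mul,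
    h.mul_zpow, mul_inv_cancel_right]

theorem commutatorElement_pow_right {a b : G} (h : Commute ⁅a, b⁆ b) (k : ℕ) :
    ⁅a, b ^ k⁆ = ⁅a, b⁆ ^ k :=
  mod_cast commutatorElement_zpow_right h k

theorem commutatorElement_pow_mem_iff {N : Subgroup G} [N.Normal] {a b : G} (h : ⁅⁅a, b⁆, b⁆ ∈ N)
    (k : ℕ) : ⁅a, b ^ k⁆ ∈ N ↔ ⁅a, b⁆ ^ k ∈ N := by
  have hpow : ⁅(a : G ⧸ N), (b : G ⧸ N) ^ k⁆ = ⁅(a : G ⧸ N), (b : G ⧸ N)⁆ ^ k :=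
    commutatorElement_pow_right (commute_mk_iff.mpr h) k
  rw [← QuotientGroup.eq_one_iff, ← QuotientGroup.eq_one_iff]
  exact Eq.congr_left hpow

/-- The centralizer of `a` modulo a normal subgroup `N`, i.e. the elements whose images in `G ⧸ N`
commute with that of `a`. As it is a subgroup, `⁅a, z⁆ ∈ N` can be checked on generators. -/
def centralizerMod (N : Subgroup G) [N.Normal] (a : G) : Subgroup G :=
  (centralizer {(a : G ⧸ N)}).comap (QuotientGroup.mk' N)

theorem mem_centralizerMod {N : Subgroup G} [N.Normal] {a z : G} :
    z ∈ centralizerMod N a ↔ ⁅a, z⁆ ∈ N := by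
  rw [centralizerMod, mem_comap, mem_centralizer_singleton_iff, ← commute_mk_iff]
  exact eq_comm

theorem le_centralizerMod (N : Subgroup G) [N.Normal] (a : G) : N ≤ centralizerMod N a :=
  fun _ hz => mem_centralizerMod.mpr (commutator_le_right ⊤ N
    (commutator_mem_commutator (mem_top a) hz))

theorem commutatorElement_mem_of_closure_eq_top {N : Subgroup G} [N.Normal] {S : Set G}
    (hS : closure S = ⊤) {z : G} (hz : ∀ s ∈ S, ⁅s, z⁆ ∈ N) (g : G) : ⁅g, z⁆ ∈ N := by
  have hle : closure S ≤ centralizerMod N z := (closure_le _).mpr fun s hs =>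
    mem_centralizerMod.mpr (commutatorElement_mem_comm.mp (hz s hs))
  exact commutatorElement_mem_comm.mp (mem_centralizerMod.mp (hle (hS ▸ mem_top g)))

theorem commutator_closure_le {S T : Set G} {N : Subgroup G} [N.Normal]
    (h : ∀ a ∈ S, ∀ b ∈ T, ⁅a, b⁆ ∈ N) : ⁅closure S, closure T⁆ ≤ N := by
  refine Subgroup.commutator_le.mpr fun a ha b hb => ?_
  have hT : ∀ t ∈ T, closure S ≤ centralizerMod N t := fun t ht => (closure_le _).mpr fun s hs =>
    mem_centralizerMod.mpr (commutatorElement_mem_comm.mp (h s hs t ht))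
  have ha' : closure T ≤ centralizerMod N a := (closure_le _).mpr fun t ht =>
    mem_centralizerMod.mpr (commutatorElement_mem_comm.mp (mem_centralizerMod.mp (hT t ht ha)))
  exact mem_centralizerMod.mp (ha' hb)

theorem commutator_commutator_le_of_rotate {H₁ H₂ H₃ N : Subgroup G} [N.Normal]
    (h1 : ⁅⁅H₂, H₃⁆, H₁⁆ ≤ N) (h2 : ⁅⁅H₃, H₁⁆, H₂⁆ ≤ N) : ⁅⁅H₁, H₂⁆, H₃⁆ ≤ N := by
  have le_iff_map_eq_bot (K : Subgroup G) : K ≤ N ↔ K.map (QuotientGroup.mk' N) = ⊥ := by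
    rw [Subgroup.map_eq_bot_iff, QuotientGroup.ker_mk']
  rw [le_iff_map_eq_bot, Subgroup.map_commutator, Subgroup.map_commutator] at *
  exact Subgroup.commutator_commutator_eq_bot_of_rotate h1 h2

theorem zpowers_sup_normal {N : Subgroup G} [N.Normal] {z : G} (hz : ∀ g : G, ⁅g, z⁆ ∈ N) :
    (zpowers z ⊔ N).Normal := by
  have hle (g : G) : zpowers z ⊔ N ≤ centralizerMod N g :=
    sup_le (zpowers_le.mpr (mem_centralizerMod.mpr (hz g))) (le_centralizerMod N g)
  exact commutator_top_left_le_iff.mp (Subgroup.commutator_le.mpr fun g _ w hw =>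
    mem_sup_right (mem_centralizerMod.mp (hle g hw)))

theorem zpowers_sup_eq_comap (N : Subgroup G) [N.Normal] (z : G) :
    zpowers z ⊔ N = (zpowers (z : G ⧸ N)).comap (QuotientGroup.mk' N) := by
  have h := comap_map_eq (QuotientGroup.mk' N) (zpowers z)
  rw [QuotientGroup.ker_mk', MonoidHom.map_zpowers] at h
  exact h.symm

theorem mem_zpowers_sup_iff {N : Subgroup G} [N.Normal] {p z : G} :
    z ∈ zpowers p ⊔ N ↔ (z : G ⧸ N) ∈ zpowers (p : G ⧸ N) := by
  rw [zpowers_sup_eq_comap, mem_comap, QuotientGroup.mk'_apply]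

theorem relIndex_dvd_of_le_zpowers_sup {N L : Subgroup G} [N.Normal] {z : G} {k : ℕ}
    (hz : z ^ k ∈ N) (hL : L ≤ zpowers z ⊔ N) : N.relIndex L ∣ k := by
  have hmap : L.map (QuotientGroup.mk' N) ≤ zpowers (z : G ⧸ N) :=
    map_le_iff_le_comap.mpr (zpowers_sup_eq_comap N z ▸ hL)
  rw [← QuotientGroup.ker_mk' N, relIndex_ker]
  refine (card_dvd_of_le hmap).trans ?_
  rw [Nat.card_zpowers]
  exact orderOf_dvd_of_pow_eq_one ((QuotientGroup.eq_one_iff (z ^ k)).mpr hz)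

end CommutatorsModulo

section CovBy

variable {G : Type*} [Group G]

theorem covBy_of_relIndex_prime {N L : Subgroup G} (hle : N ≤ L) (h : (N.relIndex L).Prime) :
    N ⋖ L := by
  refine ⟨lt_of_le_of_ne hle ?_, fun K hNK hKL => ?_⟩
  · rintro rfl
    exact Nat.not_prime_one (relIndex_self N ▸ h)
  · rw [← relIndex_mul_relIndex N K L hNK.le hKL.le, Nat.prime_mul_iff, relIndex_eq_one,
      relIndex_eq_one] at h
    exact h.elim (fun h' => hKL.not_ge h'.2) fun h' => hNK.not_ge h'.2

theorem isCoatom_of_index_prime {H : Subgroup G} (h : H.index.Prime) : IsCoatom H :=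
  covBy_top_iff.mp (covBy_of_relIndex_prime le_top (by rwa [relIndex_top_right]))

theorem le_zpowers_sup_of_notMem {N L : Subgroup G} (hle : N ≤ L) (h : (N.relIndex L).Prime) {z : G}
    (hz : z ∈ L) (hzN : z ∉ N) : L ≤ zpowers z ⊔ N := by
  have hcov := (covBy_of_relIndex_prime hle h).eq_or_eq le_sup_right
    (sup_le (zpowers_le.mpr hz) hle : zpowers z ⊔ N ≤ L)
  exact (hcov.resolve_left fun e => hzN (e ▸ mem_sup_left (mem_zpowers z))).ge

end CovBy

section LowerCentralSeries

variable {G : Type*} [Group G]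

theorem gammaSubgroup_two : gammaSubgroup G 2 = commutator G := rfl

theorem gammaSubgroup_add_two (n : ℕ) :
    gammaSubgroup G (n + 2) = ⁅gammaSubgroup G (n + 1), (⊤ : Subgroup G)⁆ := rfl

instance gammaSubgroup_normal (n : ℕ) : (gammaSubgroup G n).Normal :=
  Subgroup.lowerCentralSeries_normal _ _

theorem gammaSubgroup_antitone : Antitone (gammaSubgroup G) := fun _ _ h =>
  Subgroup.lowerCentralSeries_antitone (S := (⊤ : Subgroup G)) (Nat.sub_le_sub_right h 1)

theorem commutator_gammaSubgroup_le (i j : ℕ) :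
    ⁅gammaSubgroup G (i + 1), gammaSubgroup G (j + 1)⁆ ≤ gammaSubgroup G (i + j + 2) := by
  induction j generalizing i with
  | zero => exact le_rfl
  | succ j ih =>
    rw [gammaSubgroup_add_two, Subgroup.commutator_comm]
    refine commutator_commutator_le_of_rotate ?_ (Subgroup.commutator_mono (ih i) le_rfl)
    rw [Subgroup.commutator_comm ⊤]
    exact (ih (i + 1)).trans (gammaSubgroup_antitone (by lia))

theorem commutatorElement_mem_gammaSubgroup {i j k : ℕ} {a b : G} (ha : a ∈ gammaSubgroup G i)
    (hb : b ∈ gammaSubgroup G j) (hk : k ≤ i + j) : ⁅a, b⁆ ∈ gammaSubgroup G k := by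
  have hab := commutator_mem_commutator ha hb
  match i, j with
  | 0, j => exact gammaSubgroup_antitone (by lia : k ≤ j) (commutator_le_right _ _ hab)
  | i, 0 => exact gammaSubgroup_antitone (by lia : k ≤ i) (commutator_le_left _ _ hab)
  | i + 1, j + 1 =>
    exact gammaSubgroup_antitone (by lia) (commutator_gammaSubgroup_le i j hab)

theorem commutatorElement_mem_gammaSubgroup_succ {n : ℕ} {b : G} (a : G)
    (hb : b ∈ gammaSubgroup G n) : ⁅a, b⁆ ∈ gammaSubgroup G (n + 1) :=
  commutatorElement_mem_gammaSubgroup (i := 1) (mem_top a) hb (by lia)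

theorem commutatorElement_mem_gammaSubgroup_two (a b : G) : ⁅a, b⁆ ∈ gammaSubgroup G 2 :=
  commutatorElement_mem_gammaSubgroup_succ (n := 1) a (mem_top b)

theorem commutatorElement_mem_gammaSubgroup_three (a b c : G) : ⁅a, ⁅b, c⁆⁆ ∈ gammaSubgroup G 3 :=
  commutatorElement_mem_gammaSubgroup_succ a (commutatorElement_mem_gammaSubgroup_two b c)

theorem commute_mk_of_mem_gammaSubgroup {i j k : ℕ} {a b : G} (ha : a ∈ gammaSubgroup G i)
    (hb : b ∈ gammaSubgroup G j) (hk : k ≤ i + j) :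
    Commute (a : G ⧸ gammaSubgroup G k) (b : G ⧸ gammaSubgroup G k) :=
  commute_mk_iff.mpr (commutatorElement_mem_gammaSubgroup ha hb hk)

theorem commute_mk_of_mem_gammaSubgroup_pred {n : ℕ} {b : G} (hb : b ∈ gammaSubgroup G n)
    (a : G ⧸ gammaSubgroup G (n + 1)) : Commute (b : G ⧸ gammaSubgroup G (n + 1)) a := by
  obtain ⟨a, rfl⟩ := QuotientGroup.mk_surjective a
  exact (commute_mk_iff.mpr (commutatorElement_mem_gammaSubgroup_succ a hb)).symm

theorem gammaSubgroup_le_centralizerMod {N : Subgroup G} [N.Normal] {n : ℕ}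
    (hN : gammaSubgroup G (n + 1) ≤ N) (a : G) : gammaSubgroup G n ≤ centralizerMod N a :=
  fun _ hz => mem_centralizerMod.mpr (hN (commutatorElement_mem_gammaSubgroup_succ a hz))

theorem zpowers_sup_gammaSubgroup_normal {n : ℕ} {z : G} (hz : z ∈ gammaSubgroup G n) :
    (zpowers z ⊔ gammaSubgroup G (n + 1)).Normal :=
  zpowers_sup_normal fun g => commutatorElement_mem_gammaSubgroup_succ g hz

theorem gammaSubgroup_succ_le_iff {N : Subgroup G} [N.Normal] {n : ℕ} :
    gammaSubgroup G (n + 2) ≤ N ↔ ∀ a, gammaSubgroup G (n + 1) ≤ centralizerMod N a := by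
  rw [gammaSubgroup_add_two, Subgroup.commutator_comm, Subgroup.commutator_le]
  simp only [SetLike.le_def, mem_centralizerMod, mem_top, true_imp_iff]

theorem gammaSubgroup_le_of_le_sup_succ [Group.IsNilpotent G] {M : Subgroup G} [M.Normal] {n : ℕ}
    (h : gammaSubgroup G (n + 1) ≤ M ⊔ gammaSubgroup G (n + 2)) : gammaSubgroup G (n + 1) ≤ M := by
  have hstep (k : ℕ) : gammaSubgroup G (n + 1) ≤ M ⊔ gammaSubgroup G (n + 1 + k) := by
    induction k with
    | zero => exact le_sup_right
    | succ k ih =>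
      refine h.trans (sup_le le_sup_left (gammaSubgroup_succ_le_iff.mpr fun a => ?_))
      exact ih.trans (sup_le (le_sup_left.trans (le_centralizerMod _ a))
        (gammaSubgroup_le_centralizerMod le_sup_right a))
  obtain ⟨c, hc⟩ := Subgroup.nilpotent_iff_lowerCentralSeries.mp ‹Group.IsNilpotent G›
  have hbot : gammaSubgroup G (n + 1 + c) = ⊥ :=
    le_bot_iff.mp ((gammaSubgroup_antitone (by lia : c + 1 ≤ _)).trans hc.le)
  simpa only [hbot, sup_bot_eq] using hstep c

theorem gammaSubgroup_eq_bot_of_le_succ [Group.IsNilpotent G] {n : ℕ}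
    (h : gammaSubgroup G (n + 1) ≤ gammaSubgroup G (n + 2)) : gammaSubgroup G (n + 1) = ⊥ :=
  le_bot_iff.mp (gammaSubgroup_le_of_le_sup_succ (h.trans le_sup_right))

theorem commutator_ne_bot_of_gammaSubgroup_three_ne_bot (h3 : gammaSubgroup G 3 ≠ ⊥) :
    commutator G ≠ ⊥ :=
  ne_bot_of_le_ne_bot h3 (gammaSubgroup_antitone (Nat.le_succ 2))

theorem commutator_le_of_isCoatom [Group.IsNilpotent G] {H : Subgroup G} (hH : IsCoatom H) :
    commutator G ≤ H := by
  have hnormal := Group.normalizerCondition_of_isNilpotent (G := G) |>.normal_of_coatom _ hH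
  by_contra hle
  have htop : H ⊔ commutator G = ⊤ := hH.2 _ (left_lt_sup.mpr hle)
  exact hH.1 (top_le_iff.mp (gammaSubgroup_le_of_le_sup_succ (n := 0) htop.ge))

theorem eq_top_of_sup_commutator_eq_top [Finite G] [Group.IsNilpotent G] {K : Subgroup G}
    (h : K ⊔ commutator G = ⊤) : K = ⊤ := by
  by_contra hK
  obtain ⟨H, hH, hKH⟩ := (eq_top_or_exists_le_coatom K).resolve_left hK
  exact hH.1 (top_le_iff.mp (h ▸ sup_le hKH (commutator_le_of_isCoatom hH)))

theorem gammaSubgroup_two_le_zpowers_sup {x y : G} (hxy : closure {x, y} = ⊤) :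
    gammaSubgroup G 2 ≤ zpowers ⁅y, x⁆ ⊔ gammaSubgroup G 3 := by
  have hnormal := zpowers_sup_gammaSubgroup_normal (commutatorElement_mem_gammaSubgroup_two y x)
  have hmem : ⁅y, x⁆ ∈ zpowers ⁅y, x⁆ ⊔ gammaSubgroup G 3 := mem_sup_left (mem_zpowers _)
  rw [gammaSubgroup_two, commutator_def, ← hxy]
  refine commutator_closure_le ?_
  rintro a (rfl | rfl) b (rfl | rfl)
  · exact commutatorElement_self (_ : G) ▸ one_mem _
  · exact commutatorElement_mem_comm.mp hmem
  · exact hmem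
  · exact commutatorElement_self (_ : G) ▸ one_mem _

theorem gammaSubgroup_le_centralizerMod_of_le_zpowers_sup {n : ℕ} {a d : G}
    (hd : gammaSubgroup G n ≤ zpowers d ⊔ gammaSubgroup G (n + 1)) {N : Subgroup G} [N.Normal]
    (hN : gammaSubgroup G (n + 2) ≤ N) (had : ⁅a, d⁆ ∈ N) :
    gammaSubgroup G n ≤ centralizerMod N a :=
  hd.trans (sup_le (zpowers_le.mpr (mem_centralizerMod.mpr had))
    (gammaSubgroup_le_centralizerMod hN a))

theorem gammaSubgroup_succ_le_of_le_zpowers_sup {x y : G} (hxy : closure {x, y} = ⊤) {n : ℕ} {d : G}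
    (hd : gammaSubgroup G (n + 1) ≤ zpowers d ⊔ gammaSubgroup G (n + 2)) {K : Subgroup G}
    [K.Normal] (hK : gammaSubgroup G (n + 3) ≤ K) (hx : ⁅x, d⁆ ∈ K) (hy : ⁅y, d⁆ ∈ K) :
    gammaSubgroup G (n + 2) ≤ K :=
  gammaSubgroup_succ_le_iff.mpr fun a =>
    gammaSubgroup_le_centralizerMod_of_le_zpowers_sup hd hK
      (commutatorElement_mem_of_closure_eq_top hxy (by rintro _ (rfl | rfl); exacts [hx, hy]) a)

/- Modulo `γ_{n+2}` the map `w ↦ ⁅g, w⁆` on `γ_n` is a homomorphism with central values, so it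
turns `w ^ k ∈ γ_{n+1}` into `⁅g, w⁆ ^ k ∈ γ_{n+2}`. -/
theorem pow_mem_gammaSubgroup_succ {k : ℕ} (h : ∀ g : G, g ^ k ∈ gammaSubgroup G 2) {n : ℕ}
    {z : G} (hz : z ∈ gammaSubgroup G (n + 1)) : z ^ k ∈ gammaSubgroup G (n + 2) := by
  induction n generalizing z with
  | zero => exact h z
  | succ n ih =>
    rw [gammaSubgroup_add_two, Subgroup.commutator_comm] at hz
    rw [← QuotientGroup.eq_one_iff, QuotientGroup.mk_pow]
    induction hz using Subgroup.closure_induction with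
    | mem u hu =>
      obtain ⟨g, -, w, hw, rfl⟩ := hu
      have hgw := commutatorElement_mem_gammaSubgroup_succ g hw
      have hcentral := commutatorElement_mem_comm.mp
        (commutatorElement_mem_gammaSubgroup_succ w hgw)
      exact (QuotientGroup.eq_one_iff (⁅g, w⁆ ^ k)).mpr ((commutatorElement_pow_mem_iff
        hcentral k).mp (commutatorElement_mem_gammaSubgroup_succ g (ih hw)))
    | one => simp only [QuotientGroup.mk_one, one_pow]
    | mul a b ha _ iha ihb =>
      have ha' : a ∈ gammaSubgroup G (n + 2) := by
        rwa [gammaSubgroup_add_two, Subgroup.commutator_comm]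
      rw [QuotientGroup.mk_mul, (commute_mk_of_mem_gammaSubgroup_pred ha' b).mul_pow, iha, ihb,
        one_mul]
    | inv a _ iha => rw [QuotientGroup.mk_inv, inv_pow, iha, inv_one]

end LowerCentralSeries

section TwoGenerator

variable {G : Type*} [Group G]

theorem zpowers_sup_commutator_ne_top [Finite G] [Group.IsNilpotent G] (hne : commutator G ≠ ⊥)
    (g : G) : zpowers g ⊔ commutator G ≠ ⊤ := by
  intro htop
  apply hne
  rw [commutator_def, ← eq_top_of_sup_commutator_eq_top htop, Subgroup.commutator_self_eq_bot_iff]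
  infer_instance

theorem commutator_le_of_closure_pair_eq_top {h g : G} (hhg : closure {h, g} = ⊤) {N : Subgroup G}
    [N.Normal] (hh : h ∈ N) : commutator G ≤ N := by
  have hmem (a : G) : ⁅a, h⁆ ∈ N := mem_centralizerMod.mp (le_centralizerMod N a hh)
  rw [commutator_def, ← hhg]
  refine commutator_closure_le ?_
  rintro a (rfl | rfl) b (rfl | rfl)
  · exact hmem _
  · exact commutatorElement_mem_comm.mp (hmem _)
  · exact hmem _
  · exact commutatorElement_self (_ : G) ▸ one_mem _

theorem zpowers_sup_eq_top_of_closure_pair_eq_top {h g : G} (hhg : closure {h, g} = ⊤)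
    {N : Subgroup G} (hh : h ∈ N) : zpowers g ⊔ N = ⊤ := by
  rw [eq_top_iff, ← hhg, closure_le]
  rintro _ (rfl | rfl)
  exacts [mem_sup_right hh, mem_sup_left (mem_zpowers _)]

theorem zpowers_sup_commutator_eq_normalClosure {h g : G} (hhg : closure {h, g} = ⊤) :
    zpowers h ⊔ commutator G = normalClosure {h} := by
  have hh : h ∈ normalClosure {h} := subset_normalClosure (Set.mem_singleton h)
  have : (zpowers h ⊔ commutator G).Normal := Normal.of_commutator_le _ le_sup_right
  refine le_antisymm (sup_le (zpowers_le.mpr hh) (commutator_le_of_closure_pair_eq_top hhg hh)) ?_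
  exact normalClosure_le_normal (Set.singleton_subset_iff.mpr (mem_sup_left (mem_zpowers h)))

theorem exists_pow_inv_mul_mem {h g : G} (hhg : closure {h, g} = ⊤) {N : Subgroup G} [N.Normal]
    (hh : h ∈ N) {k : ℕ} [NeZero k] (hg : g ^ k ∈ N) (x : G) :
    ∃ i : Fin k, (g ^ (i : ℕ))⁻¹ * x ∈ N := by
  obtain ⟨m, hm⟩ := mem_zpowers_iff.mp (mem_zpowers_sup_iff.mp
    (zpowers_sup_eq_top_of_closure_pair_eq_top hhg hh ▸ mem_top x))
  have hk : 0 < (k : ℤ) := mod_cast NeZero.pos k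
  obtain ⟨i, hi⟩ := Int.eq_ofNat_of_zero_le (m.emod_nonneg hk.ne')
  refine ⟨⟨i, by have := m.emod_lt_of_pos hk; lia⟩, QuotientGroup.eq.mp ?_⟩
  have hgk : (g : G ⧸ N) ^ k = 1 := (QuotientGroup.eq_one_iff (g ^ k)).mpr hg
  rw [QuotientGroup.mk_pow, ← zpow_natCast, ← hi, ← zpow_eq_zpow_emod' m hgk, hm]

theorem zpowers_sup_commutator_le_closure_conj {h g : G} (hhg : closure {h, g} = ⊤) {k : ℕ}
    [NeZero k] (hg : g ^ k ∈ commutator G) :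
    zpowers h ⊔ commutator G ≤ closure (Set.range fun i : Fin k => MulAut.conj (g ^ (i : ℕ)) h) ⊔
      ⁅zpowers h ⊔ commutator G, zpowers h ⊔ commutator G⁆ := by
  set H := zpowers h ⊔ commutator G with hH
  have : H.Normal := Normal.of_commutator_le _ le_sup_right
  have hh : h ∈ H := mem_sup_left (mem_zpowers h)
  rw [zpowers_sup_commutator_eq_normalClosure hhg] at hH
  conv_lhs => rw [hH]
  refine (closure_le _).mpr fun z hz => ?_
  obtain ⟨x, rfl⟩ := isConj_iff.mp (by simpa [Group.mem_conjugatesOfSet_iff] using hz : IsConj h z)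
  obtain ⟨i, hi⟩ := exists_pow_inv_mul_mem hhg hh (mem_sup_right hg : g ^ k ∈ H) x
  have hx : x * h * x⁻¹ = MulAut.conj (g ^ (i : ℕ)) ⁅(g ^ (i : ℕ))⁻¹ * x, h⁆ *
      MulAut.conj (g ^ (i : ℕ)) h := by
    simp only [MulAut.conj_apply, commutatorElement_def]
    group
  rw [hx]
  exact mul_mem (mem_sup_right (Normal.conj_mem inferInstance _
    (commutator_mem_commutator hi hh) _)) (mem_sup_left (subset_closure ⟨i, rfl⟩))

theorem rank_zpowers_sup_commutator_le [Finite G] [Group.IsNilpotent G] {h g : G}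
    (hhg : closure {h, g} = ⊤) {k : ℕ} [NeZero k] (hg : g ^ k ∈ commutator G) :
    Group.rank (zpowers h ⊔ commutator G : Subgroup G) ≤ k := by
  classical
  have hle := zpowers_sup_commutator_le_closure_conj hhg hg
  set H := zpowers h ⊔ commutator G
  have hnormal : H.Normal := Normal.of_commutator_le _ le_sup_right
  let conjugate (i : Fin k) : H := ⟨MulAut.conj (g ^ (i : ℕ)) h,
    hnormal.conj_mem _ (mem_sup_left (mem_zpowers h)) _⟩
  have htop : closure (Set.range conjugate) = ⊤ := by
    apply eq_top_of_sup_commutator_eq_top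
    apply map_injective H.subtype_injective
    rw [Subgroup.map_sup, map_subtype_commutator, MonoidHom.map_closure, ← Set.range_comp,
      ← MonoidHom.range_eq_map, range_subtype]
    exact le_antisymm (sup_le ((closure_le _).mpr (Set.range_subset_iff.mpr fun i =>
      (conjugate i).2)) (Subgroup.commutator_le_self H)) hle
  refine (Group.rank_le (S := Finset.univ.image conjugate) ?_).trans
    (Finset.card_image_le.trans_eq (Finset.card_fin k))
  rw [Finset.coe_image, Finset.coe_univ, Set.image_univ, htop]

variable [Finite G] [Group.IsNilpotent G] {p : ℕ} [Fact p.Prime]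

theorem pow_mem_commutator (hab : (commutator G).index = p ^ 2) (hne : commutator G ≠ ⊥) (g : G) :
    g ^ p ∈ commutator G := by
  have hcyclic : ¬ IsCyclic (G ⧸ commutator G) := by
    rw [isCyclic_iff_exists_zpowers_eq_top]
    rintro ⟨x, hx⟩
    obtain ⟨x, rfl⟩ := QuotientGroup.mk_surjective x
    exact zpowers_sup_commutator_ne_top hne x (by rw [zpowers_sup_eq_comap, hx, comap_top])
  have hexp := (not_isCyclic_iff_exponent_eq_prime Fact.out hab).mp hcyclic
  rw [← QuotientGroup.eq_one_iff, QuotientGroup.mk_pow, ← hexp, Monoid.pow_exponent_eq_one]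

theorem index_zpowers_sup_commutator (hab : (commutator G).index = p ^ 2)
    (hne : commutator G ≠ ⊥) {h : G} (hh : h ∉ commutator G) :
    (zpowers h ⊔ commutator G).index = p := by
  have hp : p.Prime := Fact.out
  have hdvd := relIndex_dvd_of_le_zpowers_sup (pow_mem_commutator hab hne h) le_rfl
  have hrel : (commutator G).relIndex (zpowers h ⊔ commutator G) = p :=
    ((Nat.dvd_prime hp).mp hdvd).resolve_left fun h1 =>
      hh (relIndex_eq_one.mp h1 (mem_sup_left (mem_zpowers h)))
  have hmul := relIndex_mul_index (le_sup_right : commutator G ≤ zpowers h ⊔ commutator G)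
  rw [hrel, hab, sq] at hmul
  exact Nat.eq_of_mul_eq_mul_left hp.pos hmul

theorem isCoatom_zpowers_sup_commutator (hab : (commutator G).index = p ^ 2)
    (hne : commutator G ≠ ⊥) {h : G} (hh : h ∉ commutator G) :
    IsCoatom (zpowers h ⊔ commutator G) :=
  isCoatom_of_index_prime (index_zpowers_sup_commutator hab hne hh ▸ Fact.out)

theorem closure_pair_eq_top_iff (hab : (commutator G).index = p ^ 2) (hne : commutator G ≠ ⊥)
    {h g : G} : closure {h, g} = ⊤ ↔ h ∉ commutator G ∧ g ∉ zpowers h ⊔ commutator G := by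
  refine ⟨fun hhg => ⟨fun hh => ?_, fun hg => ?_⟩, fun ⟨hh, hg⟩ => ?_⟩
  · exact zpowers_sup_commutator_ne_top hne g (zpowers_sup_eq_top_of_closure_pair_eq_top hhg hh)
  · refine zpowers_sup_commutator_ne_top hne h (eq_top_iff.mpr (hhg ▸ (closure_le _).mpr ?_))
    rintro _ (rfl | rfl)
    exacts [mem_sup_left (mem_zpowers _), hg]
  · refine eq_top_of_sup_commutator_eq_top ((isCoatom_zpowers_sup_commutator hab hne hh).2 _ ?_)
    refine lt_of_le_of_ne (sup_le_sup_right (zpowers_le.mpr (subset_closure (.inl rfl))) _) ?_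
    exact fun e => hg (e ▸ mem_sup_left (subset_closure (.inr rfl)))

theorem exists_closure_pair_eq_top (hab : (commutator G).index = p ^ 2) (hne : commutator G ≠ ⊥) :
    ∃ x y : G, closure {x, y} = ⊤ := by
  have htop : commutator G ≠ ⊤ := by
    rw [Ne, ← index_eq_one, hab]
    exact (Nat.one_lt_pow two_ne_zero (Fact.out : p.Prime).one_lt).ne'
  obtain ⟨x, -, hx⟩ := SetLike.exists_of_lt htop.lt_top
  obtain ⟨y, -, hy⟩ := SetLike.exists_of_lt (zpowers_sup_commutator_ne_top hne x).lt_top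
  exact ⟨x, y, (closure_pair_eq_top_iff hab hne).mpr ⟨hx, hy⟩⟩

theorem exists_eq_zpowers_sup_commutator_of_isCoatom (hab : (commutator G).index = p ^ 2)
    (hne : commutator G ≠ ⊥) {H : Subgroup G} (hH : IsCoatom H) :
    ∃ h g : G, closure {h, g} = ⊤ ∧ H = zpowers h ⊔ commutator G := by
  have hle := commutator_le_of_isCoatom hH
  have hlt : commutator G < H := by
    refine lt_of_le_of_ne hle ?_
    rintro rfl
    obtain ⟨x, -, hx⟩ := SetLike.exists_of_lt hH.lt_top
    exact zpowers_sup_commutator_ne_top hne x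
      (hH.2 _ (right_lt_sup.mpr (zpowers_le.not.mpr hx)))
  obtain ⟨h, hhH, hh⟩ := SetLike.exists_of_lt hlt
  have heq : H = zpowers h ⊔ commutator G := ((isCoatom_zpowers_sup_commutator hab hne hh).le_iff_eq
    hH.1).mp (sup_le (zpowers_le.mpr hhH) hle)
  obtain ⟨g, -, hg⟩ := SetLike.exists_of_lt hH.lt_top
  exact ⟨h, g, (closure_pair_eq_top_iff hab hne).mpr ⟨hh, heq ▸ hg⟩, heq⟩

theorem rank_le_of_isCoatom (hab : (commutator G).index = p ^ 2) (hne : commutator G ≠ ⊥)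
    {H : Subgroup G} (hH : IsCoatom H) : Group.rank H ≤ p := by
  obtain ⟨h, g, hhg, rfl⟩ := exists_eq_zpowers_sup_commutator_of_isCoatom hab hne hH
  exact rank_zpowers_sup_commutator_le hhg (pow_mem_commutator hab hne g)

end TwoGenerator

section IndexGammaThree

variable {G : Type*} [Group G] [Finite G] [Group.IsNilpotent G] {p : ℕ} [Fact p.Prime]

theorem relIndex_gammaSubgroup_three_two (hab : (commutator G).index = p ^ 2)
    (hne : commutator G ≠ ⊥) : (gammaSubgroup G 3).relIndex (gammaSubgroup G 2) = p := by
  obtain ⟨x, y, hxy⟩ := exists_closure_pair_eq_top hab hne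
  have hpow := pow_mem_gammaSubgroup_succ (n := 1) (pow_mem_commutator hab hne)
    (commutatorElement_mem_gammaSubgroup_two y x)
  refine ((Nat.dvd_prime Fact.out).mp (relIndex_dvd_of_le_zpowers_sup hpow
    (gammaSubgroup_two_le_zpowers_sup hxy))).resolve_left fun h1 => hne ?_
  exact gammaSubgroup_eq_bot_of_le_succ (n := 1) (relIndex_eq_one.mp h1)

theorem index_gammaSubgroup_three (hab : (commutator G).index = p ^ 2)
    (hne : commutator G ≠ ⊥) : (gammaSubgroup G 3).index = p ^ 3 := by
  have hmul := relIndex_mul_index (gammaSubgroup_antitone (G := G) (Nat.le_succ 2))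
  rw [relIndex_gammaSubgroup_three_two hab hne, gammaSubgroup_two, hab] at hmul
  rw [← hmul, pow_succ' p 2]

theorem gammaSubgroup_two_le_of_notMem (hab : (commutator G).index = p ^ 2)
    (hne : commutator G ≠ ⊥) {z : G} (hz : z ∈ gammaSubgroup G 2) (hz3 : z ∉ gammaSubgroup G 3) :
    gammaSubgroup G 2 ≤ zpowers z ⊔ gammaSubgroup G 3 :=
  le_zpowers_sup_of_notMem (gammaSubgroup_antitone (Nat.le_succ 2))
    (relIndex_gammaSubgroup_three_two hab hne ▸ Fact.out) hz hz3

end IndexGammaThree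

section Cubes

variable {G : Type*} [Group G]

theorem commutatorElement_pow_three_left {a b : G} (h : Commute ⁅a, b⁆ ⁅a, ⁅a, b⁆⁆) :
    ⁅a ^ 3, b⁆ = ⁅a, ⁅a, ⁅a, b⁆⁆⁆ * ⁅a, ⁅a, b⁆⁆ ^ 3 * ⁅a, b⁆ ^ 3 := by
  have hconj (z : G) : MulAut.conj a z = ⁅a, z⁆ * z := by
    rw [MulAut.conj_apply, commutatorElement_def, inv_mul_cancel_right]
  have hb := hconj b
  have hc := hconj ⁅a, b⁆
  have hd := hconj ⁅a, ⁅a, b⁆⁆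
  set c := ⁅a, b⁆
  set d := ⁅a, c⁆
  set e := ⁅a, d⁆
  calc ⁅a ^ 3, b⁆ = MulAut.conj a (MulAut.conj a (MulAut.conj a b)) * b⁻¹ := by
        simp only [commutatorElement_def, MulAut.conj_apply, pow_succ, pow_zero, one_mul,
          mul_inv_rev, mul_assoc]
    _ = e * d * (d * c) * (d * c * (c * b)) * b⁻¹ := by simp only [hb, hc, hd, map_mul]
    _ = e * (d * d) * (c * d) * c * c := by group
    _ = e * d ^ 3 * c ^ 3 := by simp only [h.eq, pow_succ, pow_zero, one_mul, mul_assoc]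

theorem commutatorElement_pow_three_mem_gammaSubgroup_four_iff
    (hcube : ∀ g : G, g ^ 3 ∈ gammaSubgroup G 2) {a b : G} :
    ⁅a ^ 3, b⁆ ∈ gammaSubgroup G 4 ↔ ⁅a, b⁆ ^ 3 ∈ gammaSubgroup G 4 := by
  have hc := commutatorElement_mem_gammaSubgroup_two a b
  have hd := commutatorElement_mem_gammaSubgroup_succ a hc
  have hd3 := pow_mem_gammaSubgroup_succ hcube hd
  have he := commutatorElement_mem_gammaSubgroup_succ a hd
  have hkey := commutatorElement_pow_three_left (a := (a : G ⧸ gammaSubgroup G 4)) (b := b)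
    (commute_mk_of_mem_gammaSubgroup hc hd (by norm_num))
  rw [← QuotientGroup.eq_one_iff] at he hd3 ⊢
  rw [← QuotientGroup.eq_one_iff]
  refine Eq.congr_left (hkey.trans ?_)
  exact (congrArg₂ _ (congrArg₂ _ he hd3) rfl).trans (by rw [one_mul, one_mul]; rfl)

/- If `g ^ 3 ∉ γ_3`, then `g ^ 3` generates `γ_2` modulo `γ_3`. It always commutes modulo `γ_4` with
both generators `g` and `y`, so `[γ_2, G] ≤ γ_4`, which is absurd. -/
theorem pow_three_mem_gammaSubgroup_three [Finite G] [Group.IsNilpotent G]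
    (hab : (commutator G).index = 3 ^ 2) (h3 : gammaSubgroup G 3 ≠ ⊥) (g : G) :
    g ^ 3 ∈ gammaSubgroup G 3 := by
  have hne := commutator_ne_bot_of_gammaSubgroup_three_ne_bot h3
  have hcube := pow_mem_commutator hab hne
  by_contra hg3
  have hg : g ∉ commutator G := fun hg => hg3 (pow_mem_gammaSubgroup_succ (n := 1) hcube hg)
  obtain ⟨y, -, hy⟩ := SetLike.exists_of_lt (zpowers_sup_commutator_ne_top hne g).lt_top
  have hgen {a : G} (ha : a ^ 3 ∉ gammaSubgroup G 3) :=
    gammaSubgroup_two_le_of_notMem hab hne (hcube a) ha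
  have hself (a : G) : ⁅a, a ^ 3⁆ ∈ gammaSubgroup G 4 :=
    (Commute.self_pow a 3).commutator_eq ▸ one_mem _
  have hyg : ⁅y, g ^ 3⁆ ∈ gammaSubgroup G 4 := by
    by_cases hy3 : y ^ 3 ∈ gammaSubgroup G 3
    · have hpow : ⁅y, g⁆ ^ 3 ∈ gammaSubgroup G 4 :=
        (commutatorElement_pow_three_mem_gammaSubgroup_four_iff hcube).mp
          (commutatorElement_mem_comm.mp (commutatorElement_mem_gammaSubgroup_succ g hy3))
      rw [commutatorElement_mem_comm, commutatorElement_pow_three_mem_gammaSubgroup_four_iff hcube,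
        ← commutatorElement_inv, inv_pow, inv_mem_iff]
      exact hpow
    · exact mem_centralizerMod.mp
        (gammaSubgroup_le_centralizerMod_of_le_zpowers_sup (hgen hy3) le_rfl (hself y) (hcube g))
  exact h3 (gammaSubgroup_eq_bot_of_le_succ (gammaSubgroup_succ_le_of_le_zpowers_sup
    ((closure_pair_eq_top_iff hab hne).mpr ⟨hg, hy⟩) (hgen hg3) le_rfl (hself g) hyg))

theorem commutatorElement_pow_three_mem_gammaSubgroup_four [Finite G] [Group.IsNilpotent G]
    (hab : (commutator G).index = 3 ^ 2) (h3 : gammaSubgroup G 3 ≠ ⊥) (a b : G) :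
    ⁅a, b⁆ ^ 3 ∈ gammaSubgroup G 4 :=
  (commutatorElement_pow_three_mem_gammaSubgroup_four_iff
    (pow_mem_commutator hab (commutator_ne_bot_of_gammaSubgroup_three_ne_bot h3))).mp
    (commutatorElement_mem_comm.mp (commutatorElement_mem_gammaSubgroup_succ b
      (pow_three_mem_gammaSubgroup_three hab h3 a)))

theorem commute_conj_of_pow_three_eq_one (h : ∀ a : G, a ^ 3 = 1) (x y : G) :
    Commute x (y⁻¹ * x * y) := by
  have hmul_self (a : G) : a * a = a⁻¹ :=
    eq_inv_of_mul_eq_one_left (by rw [← h a, pow_succ, pow_two])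
  have hflip (a b : G) : b * a * b = a⁻¹ * b⁻¹ * a⁻¹ := by
    calc b * a * b = b * a * (b * a) * a⁻¹ := by group
      _ = a⁻¹ * b⁻¹ * a⁻¹ := by rw [hmul_self, mul_inv_rev]
  have hsymm : x * y⁻¹ * x = y * x⁻¹ * y := by
    simpa only [inv_inv] using hflip y⁻¹ x
  refine mul_inv_eq_iff_eq_mul.mp ?_
  calc x * (y⁻¹ * x * y) * x⁻¹ = (x * y⁻¹ * x) * y * x⁻¹ := by group
    _ = y * x⁻¹ * (y * y) * x⁻¹ := by rw [hsymm]; group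
    _ = y * (x⁻¹ * y⁻¹ * x⁻¹) := by rw [hmul_self y]; group
    _ = (y * y) * x * y := by rw [← hflip x y]; group
    _ = y⁻¹ * x * y := by rw [hmul_self y]

theorem commute_commutatorElement_of_pow_three_eq_one (h : ∀ a : G, a ^ 3 = 1) (x y : G) :
    Commute x ⁅y, x⁆ := by
  have hconj := commute_conj_of_pow_three_eq_one h x y⁻¹
  rw [inv_inv] at hconj
  exact hconj.mul_right (Commute.refl x).inv_right

instance powerSubgroup_normal (n : ℕ) : (powerSubgroup G n).Normal := by
  refine ⟨fun z hz g => ?_⟩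
  have hle : powerSubgroup G n ≤ (powerSubgroup G n).comap (MulAut.conj g).toMonoidHom := by
    refine (closure_le _).mpr ?_
    rintro _ ⟨w, rfl⟩
    exact subset_closure ⟨MulAut.conj g w, (map_pow (MulAut.conj g) w n).symm⟩
  exact hle hz

theorem gammaSubgroup_three_le_powerSubgroup [Group.IsNilpotent G] {x y : G}
    (hxy : closure {x, y} = ⊤) : gammaSubgroup G 3 ≤ powerSubgroup G 3 := by
  have hexp (a : G ⧸ powerSubgroup G 3) : a ^ 3 = 1 := by
    obtain ⟨a, rfl⟩ := QuotientGroup.mk_surjective a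
    exact (QuotientGroup.eq_one_iff (a ^ 3)).mpr (subset_closure ⟨a, rfl⟩)
  have hengel (a b : G) : ⁅a, ⁅b, a⁆⁆ ∈ powerSubgroup G 3 :=
    commute_mk_iff.mp (commute_commutatorElement_of_pow_three_eq_one hexp a b)
  have hy : ⁅y, ⁅y, x⁆⁆ ∈ powerSubgroup G 3 := mem_centralizerMod.mp
    (commutatorElement_inv x y ▸ inv_mem (mem_centralizerMod.mpr (hengel y x)))
  exact gammaSubgroup_le_of_le_sup_succ (gammaSubgroup_succ_le_of_le_zpowers_sup hxy
    (gammaSubgroup_two_le_zpowers_sup hxy) le_sup_right (mem_sup_left (hengel x y))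
    (mem_sup_left hy))

theorem powerSubgroup_three_eq_gammaSubgroup_three [Finite G] [Group.IsNilpotent G]
    (hab : (commutator G).index = 3 ^ 2) (h3 : gammaSubgroup G 3 ≠ ⊥) :
    powerSubgroup G 3 = gammaSubgroup G 3 := by
  obtain ⟨x, y, hxy⟩ :=
    exists_closure_pair_eq_top hab (commutator_ne_bot_of_gammaSubgroup_three_ne_bot h3)
  refine le_antisymm ((closure_le _).mpr ?_) (gammaSubgroup_three_le_powerSubgroup hxy)
  rintro _ ⟨g, rfl⟩
  exact pow_three_mem_gammaSubgroup_three hab h3 g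

end Cubes

section DerivedSubgroupOfMaximal

theorem zpow_succ_eq_one_of_pow_three_eq {G : Type*} [Group G] {g h m : G} {i : ℤ}
    (hch : Commute ⁅g, h⁆ h) (hrc : Commute ⁅g, ⁅g, h⁆⁆ ⁅g, h⁆)
    (htr : Commute ⁅g, ⁅g, ⁅g, h⁆⁆⁆ ⁅g, ⁅g, h⁆⁆) (hgm : Commute g m) (hg3 : Commute (g ^ 3) h)
    (hc3 : Commute g (⁅g, h⁆ ^ 3)) (hh : h ^ 3 = ⁅g, ⁅g, h⁆⁆ ^ i * m) :
    ⁅g, ⁅g, ⁅g, h⁆⁆⁆ ^ (i + 1) = 1 := by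
  have hr : ⁅g, ⁅g, h⁆⁆ ^ 3 = 1 := by
    rw [← commutatorElement_pow_right hrc, hc3.commutator_eq]
  have hc : ⁅g, h⁆ ^ 3 = ⁅g, ⁅g, ⁅g, h⁆⁆⁆ ^ i := by
    rw [← commutatorElement_pow_right hch, hh, commutatorElement_mul_right_eq_mul_conj,
      hgm.commutator_eq, mul_one, mul_inv_cancel_right, commutatorElement_zpow_right htr]
  rw [add_comm, zpow_one_add, ← hc, ← hg3.commutator_eq, commutatorElement_pow_three_left hrc.symm,
    hr, mul_one]

variable {G : Type*} [Group G]

/-- The derived subgroup of `⟨h⟩G'`. When `|G : G'| = p ^ 2` the subgroups `⟨h⟩G'` with `h ∉ G'` are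
the maximal subgroups of `G`. -/
def maximalDerived (h : G) : Subgroup G :=
  ⁅zpowers h ⊔ commutator G, zpowers h ⊔ commutator G⁆

instance maximalDerived_normal (h : G) : (maximalDerived h).Normal := by
  have : (zpowers h ⊔ commutator G).Normal := Normal.of_commutator_le _ le_sup_right
  exact commutator_normal _ _

theorem commutatorElement_mem_maximalDerived (h : G) {a b : G} (ha : a ∈ commutator G)
    (hb : b ∈ commutator G) : ⁅a, b⁆ ∈ maximalDerived h :=
  commutator_mem_commutator (mem_sup_right ha) (mem_sup_right hb)

theorem commutatorElement_self_mem_maximalDerived (h : G) {a : G} (ha : a ∈ commutator G) :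
    ⁅h, a⁆ ∈ maximalDerived h :=
  commutator_mem_commutator (mem_sup_left (mem_zpowers h)) (mem_sup_right ha)

theorem index_commutator_zpowers_sup_commutator (h : G) :
    (commutator ↥(zpowers h ⊔ commutator G)).index =
      (maximalDerived h).relIndex (zpowers h ⊔ commutator G) := by
  rw [maximalDerived, ← map_subtype_commutator, relIndex, subgroupOf,
    comap_map_eq_self_of_injective (subtype_injective _)]

theorem commutator_zpowers_sup_le {K N : Subgroup G} [N.Normal] (hK : ⁅K, K⁆ ≤ N) {h : G}
    (hh : K ≤ centralizerMod N h) : ⁅zpowers h ⊔ K, zpowers h ⊔ K⁆ ≤ N := by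
  have hclosure : zpowers h ⊔ K = closure ({h} ∪ K) := by
    rw [Subgroup.closure_union, closure_eq, zpowers_eq_closure]
  rw [hclosure]
  refine commutator_closure_le ?_
  rintro a (rfl | ha) b (rfl | hb)
  · exact commutatorElement_self (_ : G) ▸ one_mem _
  · exact mem_centralizerMod.mp (hh hb)
  · exact commutatorElement_mem_comm.mp (mem_centralizerMod.mp (hh ha))
  · exact hK (commutator_mem_commutator ha hb)

theorem maximalDerived_le {h g : G} (hhg : closure {h, g} = ⊤) :
    maximalDerived h ≤ zpowers ⁅h, ⁅g, h⁆⁆ ⊔ gammaSubgroup G 4 := by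
  have hnormal := zpowers_sup_gammaSubgroup_normal
    (commutatorElement_mem_gammaSubgroup_three h g h)
  exact commutator_zpowers_sup_le ((commutator_gammaSubgroup_le 1 1).trans le_sup_right)
    (gammaSubgroup_le_centralizerMod_of_le_zpowers_sup (gammaSubgroup_two_le_zpowers_sup hhg)
      le_sup_right (mem_sup_left (mem_zpowers _)))

theorem maximalDerived_le_gammaSubgroup_three {h g : G} (hhg : closure {h, g} = ⊤) :
    maximalDerived h ≤ gammaSubgroup G 3 :=
  (maximalDerived_le hhg).trans (sup_le
    (zpowers_le.mpr (commutatorElement_mem_gammaSubgroup_three h g h))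
    (gammaSubgroup_antitone (Nat.le_succ 3)))

theorem gammaSubgroup_three_le_zpowers_sup {h g : G} (hhg : closure {h, g} = ⊤) :
    gammaSubgroup G 3 ≤ zpowers ⁅g, ⁅g, h⁆⁆ ⊔ (maximalDerived h ⊔ gammaSubgroup G 4) := by
  have hc := commutatorElement_mem_gammaSubgroup_two g h
  have hr := commutatorElement_mem_gammaSubgroup_three g g h
  have hnormal : (zpowers ⁅g, ⁅g, h⁆⁆ ⊔ (maximalDerived h ⊔ gammaSubgroup G 4)).Normal :=
    zpowers_sup_normal fun a => mem_sup_right (commutatorElement_mem_gammaSubgroup_succ a hr)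
  exact gammaSubgroup_succ_le_of_le_zpowers_sup hhg (gammaSubgroup_two_le_zpowers_sup hhg)
    (le_sup_right.trans le_sup_right)
    (mem_sup_right (mem_sup_left (commutatorElement_self_mem_maximalDerived h hc)))
    (mem_sup_left (mem_zpowers _))

theorem gammaSubgroup_three_le_maximalDerived [Group.IsNilpotent G] {h g : G}
    (hhg : closure {h, g} = ⊤) (hr : ⁅g, ⁅g, h⁆⁆ ∈ zpowers ⁅h, ⁅g, h⁆⁆ ⊔ gammaSubgroup G 4) :
    gammaSubgroup G 3 ≤ maximalDerived h := by
  have hp := commutatorElement_self_mem_maximalDerived h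
    (commutatorElement_mem_gammaSubgroup_two g h)
  refine gammaSubgroup_le_of_le_sup_succ ((gammaSubgroup_three_le_zpowers_sup hhg).trans
    (sup_le (zpowers_le.mpr ?_) le_rfl))
  exact sup_le_sup_right (zpowers_le.mpr hp) _ hr

theorem gammaSubgroup_four_le_maximalDerived [Group.IsNilpotent G] {h g : G}
    (hhg : closure {h, g} = ⊤)
    (ht : ⁅g, ⁅g, ⁅g, h⁆⁆⁆ ∈ maximalDerived h ⊔ gammaSubgroup G 5) :
    gammaSubgroup G 4 ≤ maximalDerived h := by
  set N := maximalDerived h ⊔ gammaSubgroup G 5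
  have hr := commutatorElement_mem_gammaSubgroup_three g g h
  have hrN (a : G) : ⁅a, ⁅g, ⁅g, h⁆⁆⁆ ∈ N := by
    refine commutatorElement_mem_of_closure_eq_top hhg ?_ a
    rintro _ (rfl | rfl)
    · exact mem_sup_left (commutatorElement_self_mem_maximalDerived _
        (gammaSubgroup_antitone (Nat.le_succ 2) hr))
    · exact ht
  refine gammaSubgroup_le_of_le_sup_succ (gammaSubgroup_succ_le_iff.mpr fun a =>
    (gammaSubgroup_three_le_zpowers_sup hhg).trans (sup_le ?_ (sup_le ?_ ?_)))
  · exact zpowers_le.mpr (mem_centralizerMod.mpr (hrN a))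
  · exact le_sup_left.trans (le_centralizerMod N a)
  · exact gammaSubgroup_le_centralizerMod le_sup_right a

theorem index_commutator_le_of_gammaSubgroup_four_le [Finite G] [Group.IsNilpotent G] {p : ℕ}
    [Fact p.Prime] (hab : (commutator G).index = p ^ 2) (hne : commutator G ≠ ⊥) {h g : G}
    (hhg : closure {h, g} = ⊤) (h4 : gammaSubgroup G 4 ≤ maximalDerived h) :
    (commutator ↥(zpowers h ⊔ commutator G)).index ≤ p ^ 3 := by
  have hp : 0 < p := (Fact.out : p.Prime).pos
  have hr := commutatorElement_mem_gammaSubgroup_three g g h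
  have hrel : (maximalDerived h).relIndex (gammaSubgroup G 3) ∣ p :=
    relIndex_dvd_of_le_zpowers_sup
      (h4 (pow_mem_gammaSubgroup_succ (pow_mem_commutator hab hne) hr))
      ((gammaSubgroup_three_le_zpowers_sup hhg).trans
        (sup_le_sup_left (sup_le le_rfl h4) _))
  have hindex : (maximalDerived h).index ≤ p ^ 3 * p := by
    rw [← relIndex_mul_index (maximalDerived_le_gammaSubgroup_three hhg),
      index_gammaSubgroup_three hab hne, mul_comm]
    exact Nat.mul_le_mul_left _ (Nat.le_of_dvd hp hrel)
  have hH := index_zpowers_sup_commutator hab hne ((closure_pair_eq_top_iff hab hne).mp hhg).1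
  have hmul := relIndex_mul_index (Subgroup.commutator_le_self (zpowers h ⊔ commutator G))
  rw [hH] at hmul
  rw [index_commutator_zpowers_sup_commutator]
  exact Nat.le_of_mul_le_mul_right (hmul.trans_le hindex) hp

variable [Finite G] [Group.IsNilpotent G]

theorem zpow_succ_mem_of_pow_three_eq (hab : (commutator G).index = 3 ^ 2)
    (h3 : gammaSubgroup G 3 ≠ ⊥) {h g m : G} {i : ℤ}
    (hm : m ∈ maximalDerived h ⊔ gammaSubgroup G 4) (hh : h ^ 3 = ⁅g, ⁅g, h⁆⁆ ^ i * m) :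
    ⁅g, ⁅g, ⁅g, h⁆⁆⁆ ^ (i + 1) ∈ maximalDerived h ⊔ gammaSubgroup G 5 := by
  have hself {a : G} (ha : a ∈ commutator G) :=
    commute_mk_iff.mpr (mem_sup_left (commutatorElement_self_mem_maximalDerived h ha) :
      ⁅h, a⁆ ∈ maximalDerived h ⊔ gammaSubgroup G 5)
  have hcomm {a b : G} (ha : a ∈ commutator G) (hb : b ∈ commutator G) :=
    commute_mk_iff.mpr (mem_sup_left (commutatorElement_mem_maximalDerived h ha hb) :
      ⁅a, b⁆ ∈ maximalDerived h ⊔ gammaSubgroup G 5)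
  have hg : maximalDerived h ⊔ gammaSubgroup G 4 ≤
      centralizerMod (maximalDerived h ⊔ gammaSubgroup G 5) g :=
    sup_le (le_sup_left.trans (le_centralizerMod _ g))
      (gammaSubgroup_le_centralizerMod le_sup_right g)
  have hc := commutatorElement_mem_gammaSubgroup_two g h
  have hr := commutatorElement_mem_gammaSubgroup_two g ⁅g, h⁆
  have ht := commutatorElement_mem_gammaSubgroup_two g ⁅g, ⁅g, h⁆⁆
  have hc3 := commutatorElement_pow_three_mem_gammaSubgroup_four hab h3 g h
  have hg3 := pow_mem_commutator hab (commutator_ne_bot_of_gammaSubgroup_three_ne_bot h3) g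
  refine (QuotientGroup.eq_one_iff (⁅g, ⁅g, ⁅g, h⁆⁆⁆ ^ (i + 1))).mp
    (zpow_succ_eq_one_of_pow_three_eq (hself hc).symm (hcomm hr hc) (hcomm ht hr)
      (commute_mk_iff.mpr (mem_centralizerMod.mp (hg hm))) (hself hg3).symm
      (commute_mk_iff.mpr (mem_centralizerMod.mp (hg (mem_sup_right hc3)))) ?_)
  exact congrArg _ hh

/- Writing `h ^ 3 = r ^ i * m` with `r = ⁅g, ⁅g, h⁆⁆` and `m ∈ maximalDerived h ⊔ γ_4`, the element
`t = ⁅g, r⁆` satisfies `t ^ 3 = t ^ (i + 1) = 1` modulo `maximalDerived h ⊔ γ_5`, but it generates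
`γ_4` there; so `3 ∣ i + 1`. -/
theorem pow_three_mul_mem_of_not_gammaSubgroup_four_le (hab : (commutator G).index = 3 ^ 2)
    (h3 : gammaSubgroup G 3 ≠ ⊥) {h g : G} (hhg : closure {h, g} = ⊤)
    (h4 : ¬ gammaSubgroup G 4 ≤ maximalDerived h) :
    h ^ 3 * ⁅g, ⁅g, h⁆⁆ ∈ maximalDerived h ⊔ gammaSubgroup G 4 := by
  have hcube := pow_mem_commutator hab (commutator_ne_bot_of_gammaSubgroup_three_ne_bot h3)
  have hr := commutatorElement_mem_gammaSubgroup_three g g h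
  have hr3 : ⁅g, ⁅g, h⁆⁆ ^ 3 ∈ maximalDerived h ⊔ gammaSubgroup G 4 :=
    mem_sup_right (pow_mem_gammaSubgroup_succ hcube hr)
  have ht3 : ⁅g, ⁅g, ⁅g, h⁆⁆⁆ ^ 3 ∈ maximalDerived h ⊔ gammaSubgroup G 5 :=
    mem_sup_right (pow_mem_gammaSubgroup_succ hcube (commutatorElement_mem_gammaSubgroup_succ g hr))
  obtain ⟨_, ⟨i, rfl⟩, m, hm, hrm⟩ := mem_sup_of_normal_right.mp
    (gammaSubgroup_three_le_zpowers_sup hhg (pow_three_mem_gammaSubgroup_three hab h3 h))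
  have hti := zpow_succ_mem_of_pow_three_eq hab h3 hm hrm.symm
  rw [← QuotientGroup.eq_one_iff, QuotientGroup.mk_pow] at ht3
  rw [← QuotientGroup.eq_one_iff, QuotientGroup.mk_zpow, ← orderOf_dvd_iff_zpow_eq_one,
    orderOf_eq_prime ht3 fun ht => h4 (gammaSubgroup_four_le_maximalDerived hhg
      ((QuotientGroup.eq_one_iff _).mp ht))] at hti
  obtain ⟨k, hk⟩ := hti
  have hk' : h ^ 3 * ⁅g, ⁅g, h⁆⁆ =
      (⁅g, ⁅g, h⁆⁆ ^ 3) ^ k * MulAut.conj ⁅g, ⁅g, h⁆⁆⁻¹ m := by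
    rw [← hrm, ← zpow_natCast, ← zpow_mul, ← hk, zpow_add_one, MulAut.conj_apply]
    simp only [inv_inv, mul_assoc, mul_inv_cancel_left]
  exact hk' ▸ mul_mem (zpow_mem hr3 k) (Normal.conj_mem inferInstance m hm _)

end DerivedSubgroupOfMaximal

section ClassThree

variable {G : Type*} [Group G]

theorem commutatorElement_mul_right_of_mem_center {a z c : G} (hz : z ∈ center G) :
    ⁅a, z * c⁆ = ⁅a, c⁆ := by
  have hz' (b : G) : Commute b z := mem_center_iff.mp hz b
  rw [commutatorElement_mul_right_eq_mul_conj, (hz' a).commutator_eq, one_mul,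
    ← (hz' _).eq, mul_inv_cancel_right]

theorem commutatorElement_mul_left_of_mem_center {a b c : G} (h : ⁅b, c⁆ ∈ center G) :
    ⁅a * b, c⁆ = ⁅a, c⁆ * ⁅b, c⁆ := by
  have hcomm (z : G) : Commute z ⁅b, c⁆ := mem_center_iff.mp h z
  rw [commutatorElement_mul_left_eq_conj_mul, (hcomm a).mul_inv_cancel, (hcomm _).eq]

theorem commutatorElement_inv_left_of_mem_center {a c : G} (h : ⁅a, c⁆ ∈ center G) :
    ⁅a⁻¹, c⁆ = ⁅a, c⁆⁻¹ := by
  rw [eq_inv_iff_mul_eq_one, ← commutatorElement_mul_left_of_mem_center h, inv_mul_cancel,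
    commutatorElement_one_left]

theorem commutatorElement_inv_right_of_mem_center {a c : G} (h : ⁅a, c⁆ ∈ center G) :
    ⁅a, c⁻¹⁆ = ⁅a, c⁆⁻¹ := by
  have hca : ⁅c, a⁆ ∈ center G := commutatorElement_mem_comm.mp h
  rw [← commutatorElement_inv, commutatorElement_inv_left_of_mem_center hca, commutatorElement_inv]

theorem commutatorElement_self_mul (x y : G) : ⁅y, y * x⁆ = ⁅y, ⁅y, x⁆⁆ * ⁅y, x⁆ := by
  simp only [commutatorElement_def]
  group

/- As cubes are central, `(y * x) ^ 3 = (x * y) ^ 3 = x * (y * x) ^ 2 * y`, and each commutator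
arising from the collection of `(y * x) ^ 2 = (c * x * y) ^ 2` is central or equal to `c`. -/
theorem mul_pow_three_of_class_three {x y : G} (hp : ⁅x, ⁅y, x⁆⁆ ∈ center G)
    (hq : ⁅y, ⁅y, x⁆⁆ ∈ center G) (hc : ⁅y, x⁆ ^ 3 = 1) (hxy : (x * y) ^ 3 ∈ center G) :
    (y * x) ^ 3 = ⁅x, ⁅y, x⁆⁆⁻¹ * ⁅y, ⁅y, x⁆⁆ * x ^ 3 * y ^ 3 := by
  have hmul (a b : G) : a * b = ⁅a, b⁆ * (b * a) := by
    rw [commutatorElement_def, ← mul_assoc, inv_mul_cancel_right, inv_mul_cancel_right]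
  have hyx := hmul y x
  have hxc := hmul x ⁅y, x⁆
  have hyc := hmul y ⁅y, x⁆
  set c := ⁅y, x⁆
  set p := ⁅x, c⁆
  set q := ⁅y, c⁆
  have hp' (z : G) : z * p⁻¹ = p⁻¹ * z := mem_center_iff.mp (inv_mem hp) z
  have hcc : c * c = c⁻¹ := eq_inv_of_mul_eq_one_left (by rw [← hc, pow_succ, pow_two])
  have hcx : c * x * c⁻¹ = p⁻¹ * x := by
    rw [mul_inv_eq_iff_eq_mul, mul_assoc, hxc, inv_mul_cancel_left]
  calc (y * x) ^ 3 = y * (x * y) ^ 3 * y⁻¹ := by simp only [pow_three]; group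
    _ = (x * y) ^ 3 := by rw [mem_center_iff.mp hxy, mul_inv_cancel_right]
    _ = x * (y * x) * (y * x) * y := by rw [pow_three]; group
    _ = (x * c) * x * (y * c) * x * (y * y) := by rw [hyx]; group
    _ = p * (c * x * x * q) * c * (y * x) * (y * y) := by rw [hxc, hyc]; group
    _ = p * q * (c * x * x * (c * c) * x) * (y * y * y) := by
      rw [mem_center_iff.mp hq, hyx]; group
    _ = p * q * ((c * x * c⁻¹) * (c * x * c⁻¹) * x) * (y * y * y) := by rw [hcc]; group
    _ = p * (q * p⁻¹) * (x * p⁻¹) * (x * x) * (y * y * y) := by rw [hcx]; group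
    _ = p⁻¹ * q * x ^ 3 * y ^ 3 := by
      rw [hp', hp', mul_inv_cancel_left, ← mul_assoc q, hp', pow_three', pow_three']; group

theorem commutatorElement_self_commutatorElement_self_mul {x y : G} (hq : ⁅y, ⁅y, x⁆⁆ ∈ center G) :
    ⁅y, ⁅y, y * x⁆⁆ = ⁅y, ⁅y, x⁆⁆ := by
  rw [commutatorElement_self_mul, commutatorElement_mul_right_of_mem_center hq]

theorem commutatorElement_mul_commutatorElement_self_mul {x y : G} (hp : ⁅x, ⁅y, x⁆⁆ ∈ center G)
    (hq : ⁅y, ⁅y, x⁆⁆ ∈ center G) :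
    ⁅y * x, ⁅y, y * x⁆⁆ = ⁅y, ⁅y, x⁆⁆ * ⁅x, ⁅y, x⁆⁆ := by
  rw [commutatorElement_self_mul, commutatorElement_mul_right_of_mem_center hq,
    commutatorElement_mul_left_of_mem_center hp]

theorem commutatorElement_inv_left_eq {x y : G} (hq : ⁅y, ⁅y, x⁆⁆ ∈ center G) :
    ⁅y⁻¹, x⁆ = ⁅y, ⁅y, x⁆⁆ * ⁅y, x⁆⁻¹ := by
  have hconj : y⁻¹ * ⁅y, x⁆⁻¹ * y = ⁅y⁻¹, ⁅y, x⁆⁻¹⁆ * ⁅y, x⁆⁻¹ := by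
    rw [commutatorElement_def y⁻¹, inv_inv, inv_mul_cancel_right]
  have hqi : ⁅y, ⁅y, x⁆⁻¹⁆ ∈ center G :=
    commutatorElement_inv_right_of_mem_center hq ▸ inv_mem hq
  rw [commutatorElement_inv_left, ← commutatorElement_inv y x, hconj,
    commutatorElement_inv_left_of_mem_center hqi, commutatorElement_inv_right_of_mem_center hq,
    inv_inv]

theorem commutatorElement_commutatorElement_inv_left {x y : G} (hp : ⁅x, ⁅y, x⁆⁆ ∈ center G)
    (hq : ⁅y, ⁅y, x⁆⁆ ∈ center G) : ⁅x, ⁅y⁻¹, x⁆⁆ = ⁅x, ⁅y, x⁆⁆⁻¹ := by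
  rw [commutatorElement_inv_left_eq hq, commutatorElement_mul_right_of_mem_center hq,
    commutatorElement_inv_right_of_mem_center hp]

theorem commutatorElement_inv_commutatorElement_inv_left {x y : G}
    (hq : ⁅y, ⁅y, x⁆⁆ ∈ center G) : ⁅y⁻¹, ⁅y⁻¹, x⁆⁆ = ⁅y, ⁅y, x⁆⁆ := by
  have hqi : ⁅y, ⁅y, x⁆⁻¹⁆ ∈ center G :=
    commutatorElement_inv_right_of_mem_center hq ▸ inv_mem hq
  rw [commutatorElement_inv_left_eq hq, commutatorElement_mul_right_of_mem_center hq,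
    commutatorElement_inv_left_of_mem_center hqi, commutatorElement_inv_right_of_mem_center hq,
    inv_inv]

theorem exists_zsmul_add_or_sub_eq {A : Type*} [AddCommGroup A] {p q X Y : A} {a b e f : ℤ}
    (hp : (3 : ℤ) • p = 0) (hq : (3 : ℤ) • q = 0) (h1 : a • p = X + q) (h2 : b • q = Y - p)
    (h3 : e • (q + p) = -p + q + X + Y + q) (h4 : f • (q - p) = p + q + X - Y + q) :
    (∃ k : ℤ, k • (q + p) = q) ∨ ∃ k : ℤ, k • (q - p) = q := by
  obtain rfl : X = a • p - q := by rw [h1, add_sub_cancel_right]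
  obtain rfl : Y = b • q + p := by rw [h2, sub_add_cancel]
  have h_add : (a - b - 1) • p = (e - b - 1) • (q + p) := by
    linear_combination (norm := module) -h3
  have h_sub : (a - b + 1) • q = (-f - a) • (p - q) := by
    linear_combination (norm := module) -h4
  obtain ⟨k, hk | hk | hk⟩ : ∃ k : ℤ, a - b - 1 = 3 * k ∨ a - b - 1 = 3 * k + 1 ∨
      a - b - 1 = 3 * k + 2 := ⟨(a - b - 1) / 3, by lia⟩
  · rw [show a - b + 1 = 3 * k + 2 by lia] at h_sub
    exact .inr ⟨-f - a, by linear_combination (norm := module) h_sub + (-k - 1) • hq⟩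
  · rw [hk] at h_add
    exact .inl ⟨1 - (e - b - 1), by linear_combination (norm := module) h_add - k • hp⟩
  · rw [hk] at h_add
    exact .inl ⟨1 + (e - b - 1), by linear_combination (norm := module) (k + 1) • hp - h_add⟩

theorem mem_zpowers_mul_or_of_commGroup {M : Type*} [CommGroup M] {p q X Y : M} (hp : p ^ 3 = 1)
    (hq : q ^ 3 = 1) (h1 : X * q ∈ zpowers p) (h2 : Y * p⁻¹ ∈ zpowers q)
    (h3 : p⁻¹ * q * X * Y * q ∈ zpowers (q * p))
    (h4 : p * q * X * Y⁻¹ * q ∈ zpowers (q * p⁻¹)) :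
    q ∈ zpowers (q * p) ∨ q ∈ zpowers (q * p⁻¹) := by
  simp only [mem_zpowers_iff, ← div_eq_mul_inv] at h1 h2 h3 h4 ⊢
  obtain ⟨a, h1⟩ := h1
  obtain ⟨b, h2⟩ := h2
  obtain ⟨e, h3⟩ := h3
  obtain ⟨f, h4⟩ := h4
  rw [← zpow_natCast] at hp hq
  exact exists_zsmul_add_or_sub_eq (A := Additive M) hp hq h1 h2 h3 h4

open scoped IsMulCommutative in
theorem mem_zpowers_mul_or_of_mem_center {p q X Y : G} (hpZ : p ∈ center G) (hqZ : q ∈ center G)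
    (hXZ : X ∈ center G) (hYZ : Y ∈ center G) (hp : p ^ 3 = 1)
    (hq : q ^ 3 = 1) (h1 : X * q ∈ zpowers p) (h2 : Y * p⁻¹ ∈ zpowers q)
    (h3 : p⁻¹ * q * X * Y * q ∈ zpowers (q * p))
    (h4 : p * q * X * Y⁻¹ * q ∈ zpowers (q * p⁻¹)) :
    q ∈ zpowers (q * p) ∨ q ∈ zpowers (q * p⁻¹) := by
  lift p to center G using hpZ
  lift q to center G using hqZ
  lift X to center G using hXZ
  lift Y to center G using hYZ
  simp only [mem_zpowers_iff] at h1 h2 h3 h4 ⊢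
  norm_cast at *
  exact mem_zpowers_mul_or_of_commGroup hp hq h1 h2 h3 h4

/- With `p = ⁅x, ⁅y, x⁆⁆` and `q = ⁅y, ⁅y, x⁆⁆`, the four hypotheses on pairs of generators become
relations between `x ^ 3`, `y ^ 3`, `p` and `q` in the elementary abelian centre. -/
theorem mem_zpowers_of_class_three (hγ : ∀ a b c : G, ⁅a, ⁅b, c⁆⁆ ∈ center G)
    (hexp : ∀ a b : G, ⁅a, b⁆ ^ 3 = 1) (hcube : ∀ a : G, a ^ 3 ∈ center G) {x y : G}
    (hx : x ^ 3 * ⁅y, ⁅y, x⁆⁆ ∈ zpowers ⁅x, ⁅y, x⁆⁆)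
    (hy : y ^ 3 * ⁅x, ⁅x, y⁆⁆ ∈ zpowers ⁅y, ⁅x, y⁆⁆)
    (hyx : (y * x) ^ 3 * ⁅y, ⁅y, y * x⁆⁆ ∈ zpowers ⁅y * x, ⁅y, y * x⁆⁆)
    (hyx' : (y⁻¹ * x) ^ 3 * ⁅y⁻¹, ⁅y⁻¹, y⁻¹ * x⁆⁆ ∈ zpowers ⁅y⁻¹ * x, ⁅y⁻¹, y⁻¹ * x⁆⁆) :
    ⁅y, ⁅y, y * x⁆⁆ ∈ zpowers ⁅y * x, ⁅y, y * x⁆⁆ ∨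
      ⁅y⁻¹, ⁅y⁻¹, y⁻¹ * x⁆⁆ ∈ zpowers ⁅y⁻¹ * x, ⁅y⁻¹, y⁻¹ * x⁆⁆ := by
  have hp := hγ x y x
  have hq := hγ y y x
  have hp' := hγ x y⁻¹ x
  have hq' := hγ y⁻¹ y⁻¹ x
  rw [← commutatorElement_inv y x, commutatorElement_inv_right_of_mem_center hp,
    commutatorElement_inv_right_of_mem_center hq, zpowers_inv] at hy
  rw [commutatorElement_self_commutatorElement_self_mul hq,
    commutatorElement_mul_commutatorElement_self_mul hp hq] at hyx ⊢
  rw [commutatorElement_self_commutatorElement_self_mul hq',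
    commutatorElement_mul_commutatorElement_self_mul hp' hq',
    commutatorElement_commutatorElement_inv_left hp hq,
    commutatorElement_inv_commutatorElement_inv_left hq] at hyx' ⊢
  rw [mul_pow_three_of_class_three hp hq (hexp y x) (hcube _)] at hyx
  rw [mul_pow_three_of_class_three hp' hq' (hexp y⁻¹ x) (hcube _),
    commutatorElement_commutatorElement_inv_left hp hq,
    commutatorElement_inv_commutatorElement_inv_left hq, inv_inv, inv_pow] at hyx'
  exact mem_zpowers_mul_or_of_mem_center hp hq (hcube x) (hcube y) (hexp _ _) (hexp _ _)
    hx hy hyx hyx'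

end ClassThree

section LargeMaximalDerived

variable {G : Type*} [Group G]

theorem closure_pair_mul_of_mem_zpowers {a b z : G} (hz : z ∈ zpowers b) :
    closure {z * a, b} = closure {a, b} := by
  have hleft (c : G) : c ∈ closure {c, b} := subset_closure (Set.mem_insert c _)
  have hright (c : G) : b ∈ closure {c, b} := subset_closure (Set.mem_insert_of_mem c rfl)
  have hz' (c : G) : z ∈ closure {c, b} := zpowers_le.mpr (hright c) hz
  refine le_antisymm ((closure_le _).mpr ?_) ((closure_le _).mpr ?_)
  · rintro _ (rfl | rfl)
    exacts [mul_mem (hz' a) (hleft a), hright a]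
  · rintro _ (rfl | rfl)
    exacts [(mul_mem_cancel_left (hz' _)).mp (hleft _), hright _]

theorem closure_pair_inv (a b : G) : closure {a, b⁻¹} = closure {a, b} := by
  rw [Set.insert_eq, Set.insert_eq, Subgroup.closure_union, Subgroup.closure_union,
    closure_singleton_inv]

theorem exists_commutatorElement_mem_zpowers_sup [Finite G] [Group.IsNilpotent G]
    (hab : (commutator G).index = 3 ^ 2) (h3 : gammaSubgroup G 3 ≠ ⊥)
    (hrel : ∀ h g : G, closure {h, g} = ⊤ →
      h ^ 3 * ⁅g, ⁅g, h⁆⁆ ∈ zpowers ⁅h, ⁅g, h⁆⁆ ⊔ gammaSubgroup G 4) :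
    ∃ h g : G, closure {h, g} = ⊤ ∧ ⁅g, ⁅g, h⁆⁆ ∈ zpowers ⁅h, ⁅g, h⁆⁆ ⊔ gammaSubgroup G 4 := by
  have hcen {z : G} (hz : z ∈ gammaSubgroup G 3) : (z : G ⧸ gammaSubgroup G 4) ∈ center _ :=
    mem_center_iff.mpr fun a => (commute_mk_of_mem_gammaSubgroup_pred hz a).symm
  have hγ : ∀ a b c : G ⧸ gammaSubgroup G 4, ⁅a, ⁅b, c⁆⁆ ∈ center _ := by
    rintro ⟨a⟩ ⟨b⟩ ⟨c⟩
    exact hcen (commutatorElement_mem_gammaSubgroup_three a b c)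
  have hexp : ∀ a b : G ⧸ gammaSubgroup G 4, ⁅a, b⁆ ^ 3 = 1 := by
    rintro ⟨a⟩ ⟨b⟩
    exact (QuotientGroup.eq_one_iff _).mpr
      (commutatorElement_pow_three_mem_gammaSubgroup_four hab h3 a b)
  have hcube : ∀ a : G ⧸ gammaSubgroup G 4, a ^ 3 ∈ center _ := by
    rintro ⟨a⟩
    exact hcen (pow_three_mem_gammaSubgroup_three hab h3 a)
  let π := QuotientGroup.mk' (gammaSubgroup G 4)
  have hπ {h g : G} (hhg : closure {h, g} = ⊤) :
      π h ^ 3 * ⁅π g, ⁅π g, π h⁆⁆ ∈ zpowers ⁅π h, ⁅π g, π h⁆⁆ :=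
    mem_zpowers_sup_iff.mp (hrel h g hhg)
  obtain ⟨x, y, hxy⟩ :=
    exists_closure_pair_eq_top hab (commutator_ne_bot_of_gammaSubgroup_three_ne_bot h3)
  have hyx : closure {y, x} = ⊤ := Set.pair_comm x y ▸ hxy
  have hmul : closure {y * x, y} = ⊤ := (closure_pair_mul_of_mem_zpowers (mem_zpowers y)).trans hxy
  have hmul' : closure {y⁻¹ * x, y⁻¹} = ⊤ :=
    (closure_pair_mul_of_mem_zpowers (mem_zpowers y⁻¹)).trans ((closure_pair_inv x y).trans hxy)
  refine (mem_zpowers_of_class_three hγ hexp hcube (hπ hxy) (hπ hyx) ?_ ?_).elim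
    (fun h => ⟨_, _, hmul, mem_zpowers_sup_iff.mpr h⟩)
    (fun h => ⟨_, _, hmul', mem_zpowers_sup_iff.mpr h⟩)
  · simpa only [map_mul] using hπ hmul
  · simpa only [map_mul, map_inv] using hπ hmul'

theorem exists_gammaSubgroup_four_le_maximalDerived [Finite G] [Group.IsNilpotent G]
    (hab : (commutator G).index = 3 ^ 2) (h3 : gammaSubgroup G 3 ≠ ⊥) :
    ∃ h g : G, closure {h, g} = ⊤ ∧ gammaSubgroup G 4 ≤ maximalDerived h := by
  by_contra! hcon
  obtain ⟨h, g, hhg, hr⟩ := exists_commutatorElement_mem_zpowers_sup hab h3 fun h g hhg =>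
    sup_le (maximalDerived_le hhg) le_sup_right
      (pow_three_mul_mem_of_not_gammaSubgroup_four_le hab h3 hhg (hcon h g hhg))
  exact hcon h g hhg ((gammaSubgroup_antitone (Nat.le_succ 3)).trans
    (gammaSubgroup_three_le_maximalDerived hhg hr))

theorem exists_isCoatom_index_commutator_le [Finite G] [Group.IsNilpotent G]
    (hab : (commutator G).index = 3 ^ 2) (h3 : gammaSubgroup G 3 ≠ ⊥) :
    ∃ H : Subgroup G, IsCoatom H ∧ (commutator H).index ≤ 27 := by
  have hne := commutator_ne_bot_of_gammaSubgroup_three_ne_bot h3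
  obtain ⟨h, g, hhg, h4⟩ := exists_gammaSubgroup_four_le_maximalDerived hab h3
  exact ⟨zpowers h ⊔ commutator G,
    isCoatom_zpowers_sup_commutator hab hne ((closure_pair_eq_top_iff hab hne).mp hhg).1,
    index_commutator_le_of_gammaSubgroup_four_le hab hne hhg h4⟩

end LargeMaximalDerived

section MaximalClass

variable {G : Type*} [Group G]

theorem commute_inv_mul_of_commutatorElement_eq {a b c : G} (h : ⁅c, a⁆ = ⁅c, b⁆) :
    Commute c (a⁻¹ * b) := by
  have hconj : a * c⁻¹ * a⁻¹ = b * c⁻¹ * b⁻¹ := by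
    simpa only [commutatorElement_def, mul_assoc, mul_right_inj] using h
  refine Commute.inv_left_iff.mp ?_
  calc c⁻¹ * (a⁻¹ * b) = a⁻¹ * (a * c⁻¹ * a⁻¹) * b := by group
    _ = a⁻¹ * b * c⁻¹ := by rw [hconj]; group

theorem exists_closure_pair_gammaSubgroup_two_le_centralizerMod [Finite G] [Group.IsNilpotent G]
    {p : ℕ} [Fact p.Prime] (hab : (commutator G).index = p ^ 2) (hne : commutator G ≠ ⊥)
    (h43 : (gammaSubgroup G 4).relIndex (gammaSubgroup G 3) = p) :
    ∃ a s : G, closure {a, s} = ⊤ ∧ gammaSubgroup G 2 ≤ centralizerMod (gammaSubgroup G 4) a := by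
  obtain ⟨x, y, hxy⟩ := exists_closure_pair_eq_top hab hne
  suffices ∃ a s : G, closure {a, s} = ⊤ ∧ ⁅⁅y, x⁆, a⁆ ∈ gammaSubgroup G 4 by
    obtain ⟨a, s, has, ha⟩ := this
    exact ⟨a, s, has, gammaSubgroup_le_centralizerMod_of_le_zpowers_sup
      (gammaSubgroup_two_le_zpowers_sup hxy) le_rfl (commutatorElement_mem_comm.mp ha)⟩
  have hc (a : G) : ⁅⁅y, x⁆, a⁆ ∈ gammaSubgroup G 3 :=
    commutatorElement_mem_comm.mp (commutatorElement_mem_gammaSubgroup_three a y x)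
  by_cases hy : ⁅⁅y, x⁆, y⁆ ∈ gammaSubgroup G 4
  · exact ⟨y, x, Set.pair_comm x y ▸ hxy, hy⟩
  have hle := le_zpowers_sup_of_notMem (gammaSubgroup_antitone (Nat.le_succ 3))
    (h43 ▸ Fact.out) (hc y) hy
  obtain ⟨i, hi⟩ := mem_zpowers_iff.mp (mem_zpowers_sup_iff.mp (hle (hc x)))
  refine ⟨(y ^ i)⁻¹ * x, y,
    (closure_pair_mul_of_mem_zpowers (inv_mem (zpow_mem (mem_zpowers y) i))).trans hxy, ?_⟩
  have hpow : ⁅((⁅y, x⁆ : G) : G ⧸ gammaSubgroup G 4), (y : G ⧸ gammaSubgroup G 4) ^ i⁆ =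
      ((⁅⁅y, x⁆, y⁆ : G) : G ⧸ gammaSubgroup G 4) ^ i :=
    commutatorElement_zpow_right (commute_mk_of_mem_gammaSubgroup_pred (hc y) y) i
  have hcomm := commute_inv_mul_of_commutatorElement_eq (b := (x : G ⧸ gammaSubgroup G 4))
    (hpow.trans hi)
  exact commute_mk_iff.mp hcomm

theorem commutator_gammaSubgroup_two_le {x y : G} (hxy : closure {x, y} = ⊤) :
    ⁅gammaSubgroup G 2, gammaSubgroup G 2⁆ ≤ gammaSubgroup G 5 := by
  have hle : gammaSubgroup G 3 ≤ centralizerMod (gammaSubgroup G 5) ⁅y, x⁆ := fun z hz =>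
    mem_centralizerMod.mpr (commutatorElement_mem_gammaSubgroup
      (commutatorElement_mem_gammaSubgroup_two y x) hz le_rfl)
  exact (commutator_mono (gammaSubgroup_two_le_zpowers_sup hxy)
    (gammaSubgroup_two_le_zpowers_sup hxy)).trans (commutator_zpowers_sup_le
      ((commutator_gammaSubgroup_le 2 2).trans (gammaSubgroup_antitone (Nat.le_succ 5))) hle)

theorem gammaSubgroup_three_le_centralizerMod {a s : G} (has : closure {a, s} = ⊤)
    (h2 : gammaSubgroup G 2 ≤ centralizerMod (gammaSubgroup G 4) a) :
    gammaSubgroup G 3 ≤ centralizerMod (gammaSubgroup G 5) a := by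
  have ha : ⁅zpowers a, gammaSubgroup G 2⁆ ≤ gammaSubgroup G 4 := by
    rw [zpowers_eq_closure, ← closure_eq (gammaSubgroup G 2)]
    refine commutator_closure_le ?_
    rintro _ rfl z hz
    exact mem_centralizerMod.mp (h2 hz)
  have hrotate : ⁅⁅gammaSubgroup G 2, ⊤⁆, zpowers a⁆ ≤ gammaSubgroup G 5 :=
    commutator_commutator_le_of_rotate
      ((commutator_mono (commutator_mono le_top le_top) le_rfl).trans
        (commutator_gammaSubgroup_two_le has))
      (commutator_mono ha le_rfl)
  exact fun z hz => mem_centralizerMod.mpr (commutatorElement_mem_comm.mp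
    (hrotate (commutator_mem_commutator hz (mem_zpowers a))))

/-- The right-normed commutator `⁅s, ⁅s, …, ⁅s, a⁆⁆⁆` with `k` entries `s`, a candidate
generator of `γ_{k+1}` modulo `γ_{k+2}`. -/
def engelCommutator (s a : G) (k : ℕ) : G :=
  (fun z => ⁅s, z⁆)^[k] a

theorem engelCommutator_succ (s a : G) (k : ℕ) :
    engelCommutator s a (k + 1) = ⁅s, engelCommutator s a k⁆ :=
  Function.iterate_succ_apply' _ k a

theorem engelCommutator_mem_gammaSubgroup (s a : G) (k : ℕ) :
    engelCommutator s a k ∈ gammaSubgroup G (k + 1) := by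
  induction k with
  | zero => exact mem_top a
  | succ k ih =>
    rw [engelCommutator_succ]
    exact commutatorElement_mem_gammaSubgroup_succ s ih

theorem gammaSubgroup_le_zpowers_engelCommutator_succ {s a : G} (has : closure {a, s} = ⊤) {k : ℕ}
    (hk : gammaSubgroup G (k + 1) ≤ zpowers (engelCommutator s a k) ⊔ gammaSubgroup G (k + 2))
    (ha : gammaSubgroup G (k + 1) ≤ centralizerMod (gammaSubgroup G (k + 3)) a) :
    gammaSubgroup G (k + 2) ≤
      zpowers (engelCommutator s a (k + 1)) ⊔ gammaSubgroup G (k + 3) := by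
  have hnormal := zpowers_sup_gammaSubgroup_normal (engelCommutator_mem_gammaSubgroup s a (k + 1))
  refine gammaSubgroup_succ_le_of_le_zpowers_sup has hk le_sup_right
    (mem_sup_right (mem_centralizerMod.mp (ha (engelCommutator_mem_gammaSubgroup s a k))))
    (mem_sup_left ?_)
  rw [← engelCommutator_succ]
  exact mem_zpowers _

section CubeInGammaFour

variable {s : G} (hs : s ^ 3 ∈ gammaSubgroup G 4)
include hs

theorem commutatorElement_mul_pow_three_mul_pow_three_mem {n : ℕ} {a : G}
    (ha : a ∈ gammaSubgroup G (n + 1)) :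
    ⁅s, ⁅s, ⁅s, a⁆⁆⁆ * ⁅s, ⁅s, a⁆⁆ ^ 3 * ⁅s, a⁆ ^ 3 ∈ gammaSubgroup G (n + 5) := by
  have hc := commutatorElement_mem_gammaSubgroup_succ s ha
  have hd := commutatorElement_mem_gammaSubgroup_succ s hc
  have h := commutatorElement_mem_gammaSubgroup hs ha (by lia : n + 5 ≤ _)
  have hkey := commutatorElement_pow_three_left (a := (s : G ⧸ gammaSubgroup G (n + 5))) (b := a)
    (commute_mk_of_mem_gammaSubgroup hc hd (by lia))
  exact (QuotientGroup.eq_one_iff _).mp (hkey.symm.trans ((QuotientGroup.eq_one_iff _).mpr h))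

theorem commutatorElement_pow_three_mem (hcube : ∀ g : G, g ^ 3 ∈ gammaSubgroup G 2) {n : ℕ} {a : G}
    (ha : a ∈ gammaSubgroup G (n + 1)) : ⁅s, a⁆ ^ 3 ∈ gammaSubgroup G (n + 4) := by
  have hd := commutatorElement_mem_gammaSubgroup_succ s
    (commutatorElement_mem_gammaSubgroup_succ s ha)
  exact (mul_mem_cancel_left (mul_mem (commutatorElement_mem_gammaSubgroup_succ s hd)
    (pow_mem_gammaSubgroup_succ hcube hd))).mp (gammaSubgroup_antitone (Nat.le_succ (n + 4))
      (commutatorElement_mul_pow_three_mul_pow_three_mem hs ha))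

theorem commutatorElement_mul_pow_three_mem (hcube : ∀ g : G, g ^ 3 ∈ gammaSubgroup G 2) {n : ℕ}
    {a : G} (ha : a ∈ gammaSubgroup G (n + 1)) :
    ⁅s, ⁅s, ⁅s, a⁆⁆⁆ * ⁅s, a⁆ ^ 3 ∈ gammaSubgroup G (n + 5) := by
  have hd3 := commutatorElement_pow_three_mem hs hcube
    (commutatorElement_mem_gammaSubgroup_succ s ha)
  have h := commutatorElement_mul_pow_three_mul_pow_three_mem hs ha
  rw [← QuotientGroup.eq_one_iff] at hd3 h ⊢
  rwa [QuotientGroup.mk_mul, QuotientGroup.mk_mul, hd3, mul_one] at h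

theorem pow_three_mem_of_le_zpowers_engelCommutator (hcube : ∀ g : G, g ^ 3 ∈ gammaSubgroup G 2)
    {a : G} {k : ℕ} (hk : gammaSubgroup G (k + 2) ≤
      zpowers (engelCommutator s a (k + 1)) ⊔ gammaSubgroup G (k + 3))
    {z : G} (hz : z ∈ gammaSubgroup G (k + 2)) : z ^ 3 ∈ gammaSubgroup G (k + 4) := by
  have he := engelCommutator_mem_gammaSubgroup s a (k + 1)
  have he3 : engelCommutator s a (k + 1) ^ 3 ∈ gammaSubgroup G (k + 4) := by
    rw [engelCommutator_succ]
    exact commutatorElement_pow_three_mem hs hcube (engelCommutator_mem_gammaSubgroup s a k)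
  obtain ⟨_, ⟨i, rfl⟩, w, hw, rfl⟩ := mem_sup_of_normal_right.mp (hk hz)
  have hw3 := pow_mem_gammaSubgroup_succ hcube hw
  have hcomm := commute_mk_of_mem_gammaSubgroup (zpow_mem he i) hw (by lia : k + 4 ≤ _)
  have hei : (engelCommutator s a (k + 1) ^ i) ^ 3 ∈ gammaSubgroup G (k + 4) := by
    rw [← zpow_natCast, zpow_comm, zpow_natCast]
    exact zpow_mem he3 i
  rw [← QuotientGroup.eq_one_iff, QuotientGroup.mk_pow] at hw3 hei ⊢
  exact (hcomm.mul_pow 3).trans (by rw [hei, hw3, one_mul])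

/- The relation `e_{k+3} ≡ e_{k+1}⁻³` modulo `γ_{k+5}` reduces `⁅a, e_{k+3}⁆` to the cube of
`⁅a, e_{k+1}⁆`. -/
theorem gammaSubgroup_le_centralizerMod_add_two (hcube : ∀ g : G, g ^ 3 ∈ gammaSubgroup G 2)
    {a : G} {k : ℕ} (hk : gammaSubgroup G (k + 4) ≤
      zpowers (engelCommutator s a (k + 3)) ⊔ gammaSubgroup G (k + 5))
    (ha : gammaSubgroup G (k + 2) ≤ centralizerMod (gammaSubgroup G (k + 4)) a) :
    gammaSubgroup G (k + 4) ≤ centralizerMod (gammaSubgroup G (k + 6)) a := by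
  have he := engelCommutator_mem_gammaSubgroup s a (k + 1)
  have hae := mem_centralizerMod.mp (ha he)
  have hrel : engelCommutator s a (k + 3) * engelCommutator s a (k + 1) ^ 3 ∈
      gammaSubgroup G (k + 5) := by
    simpa only [engelCommutator_succ] using commutatorElement_mul_pow_three_mem hs hcube
      (engelCommutator_mem_gammaSubgroup s a k)
  have he3 : engelCommutator s a (k + 1) ^ 3 ∈ centralizerMod (gammaSubgroup G (k + 6)) a :=
    mem_centralizerMod.mpr ((commutatorElement_pow_mem_iff
      (commutatorElement_mem_gammaSubgroup hae he (by lia)) 3).mpr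
        (pow_three_mem_of_le_zpowers_engelCommutator hs hcube hk hae))
  exact gammaSubgroup_le_centralizerMod_of_le_zpowers_sup hk le_rfl (mem_centralizerMod.mp
    ((mul_mem_cancel_right he3).mp (gammaSubgroup_le_centralizerMod le_rfl a hrel)))

theorem gammaSubgroup_le_zpowers_engelCommutator_sup (hcube : ∀ g : G, g ^ 3 ∈ gammaSubgroup G 2)
    {a : G} (has : closure {a, s} = ⊤)
    (h2 : gammaSubgroup G 2 ≤ centralizerMod (gammaSubgroup G 4) a) (k : ℕ) :
    gammaSubgroup G (k + 2) ≤
      zpowers (engelCommutator s a (k + 1)) ⊔ gammaSubgroup G (k + 3) := by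
  suffices gammaSubgroup G (k + 2) ≤
        zpowers (engelCommutator s a (k + 1)) ⊔ gammaSubgroup G (k + 3) ∧
      gammaSubgroup G (k + 2) ≤ centralizerMod (gammaSubgroup G (k + 4)) a ∧
      gammaSubgroup G (k + 3) ≤ centralizerMod (gammaSubgroup G (k + 5)) a from this.1
  induction k with
  | zero =>
    exact ⟨gammaSubgroup_two_le_zpowers_sup has, h2, gammaSubgroup_three_le_centralizerMod has h2⟩
  | succ k ih =>
    obtain ⟨hk, ha, ha'⟩ := ih
    have hk' := gammaSubgroup_le_zpowers_engelCommutator_succ has hk ha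
    have hk'' := gammaSubgroup_le_zpowers_engelCommutator_succ has hk' ha'
    exact ⟨hk', ha', gammaSubgroup_le_centralizerMod_add_two hs hcube hk'' ha⟩

end CubeInGammaFour

theorem index_gammaSubgroup_of_relIndex_dvd [Group.IsNilpotent G] {p : ℕ} [Fact p.Prime]
    (hab : (commutator G).index = p ^ 2)
    (h : ∀ n, (gammaSubgroup G (n + 3)).relIndex (gammaSubgroup G (n + 2)) ∣ p) {n : ℕ}
    (hn : gammaSubgroup G (n + 1) ≠ ⊥) : (gammaSubgroup G (n + 2)).index = p ^ (n + 2) := by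
  induction n with
  | zero => exact hab
  | succ n ih =>
    have hle := gammaSubgroup_antitone (G := G) (Nat.le_succ (n + 2))
    have hn' : gammaSubgroup G (n + 1) ≠ ⊥ := fun hbot =>
      hn (le_bot_iff.mp (hbot ▸ gammaSubgroup_antitone (Nat.le_succ (n + 1))))
    obtain h1 | hp := (Nat.dvd_prime Fact.out).mp (h n)
    · exact absurd (gammaSubgroup_eq_bot_of_le_succ (relIndex_eq_one.mp h1)) hn
    · rw [← relIndex_mul_index hle, hp, ih hn', pow_succ' p (n + 2)]

theorem isOfMaximalClass_of_relIndex_dvd [Group.IsNilpotent G] {p : ℕ} [Fact p.Prime]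
    (hab : (commutator G).index = p ^ 2) (hne : commutator G ≠ ⊥)
    (h : ∀ n, (gammaSubgroup G (n + 3)).relIndex (gammaSubgroup G (n + 2)) ∣ p) :
    IsOfMaximalClass p G := by
  have hbot (n : ℕ) : gammaSubgroup G (n + 1) = ⊥ ↔ Group.nilpotencyClass G ≤ n :=
    Subgroup.lowerCentralSeries_eq_bot_iff_nilpotencyClass_le
  have hc : 1 < Group.nilpotencyClass G := not_le.mp fun hle => hne ((hbot 1).mpr hle)
  obtain ⟨m, hm⟩ := Nat.exists_eq_add_of_lt hc
  refine ⟨m + 3, Nat.le_add_left 3 m, ?_, inferInstance, by lia⟩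
  rw [← index_bot, ← (hbot (m + 2)).mpr (by lia)]
  exact index_gammaSubgroup_of_relIndex_dvd hab h (n := m + 1) fun hm' => by
    have := (hbot (m + 1)).mp hm'
    lia

/- If `s ^ 3 ∉ γ_4`, then `s ^ 3` generates `γ_3` modulo `γ_4`, and it commutes modulo `γ_5` with
both generators `a` and `s`. -/
theorem pow_three_mem_gammaSubgroup_four [Finite G] [Group.IsNilpotent G]
    (hab : (commutator G).index = 3 ^ 2)
    (h43 : (gammaSubgroup G 4).relIndex (gammaSubgroup G 3) = 3) (h4 : gammaSubgroup G 4 ≠ ⊥)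
    {a s : G} (has : closure {a, s} = ⊤)
    (h2 : gammaSubgroup G 2 ≤ centralizerMod (gammaSubgroup G 4) a) :
    s ^ 3 ∈ gammaSubgroup G 4 := by
  by_contra hs
  have hle := gammaSubgroup_antitone (G := G) (Nat.le_succ 3)
  have hs3 := pow_three_mem_gammaSubgroup_three hab (ne_bot_of_le_ne_bot h4 hle) s
  have hgen := le_zpowers_sup_of_notMem hle (h43.symm ▸ Nat.prime_three) hs3 hs
  have has3 := mem_centralizerMod.mp (gammaSubgroup_three_le_centralizerMod has h2 hs3)
  have hss3 : ⁅s, s ^ 3⁆ ∈ gammaSubgroup G 5 :=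
    (Commute.self_pow s 3).commutator_eq ▸ one_mem _
  exact h4 (gammaSubgroup_eq_bot_of_le_succ
    (gammaSubgroup_succ_le_of_le_zpowers_sup has hgen le_rfl has3 hss3))

theorem isOfMaximalClass_of_index_gammaSubgroup_four [Finite G] [Group.IsNilpotent G]
    (hab : (commutator G).index = 3 ^ 2) (h3 : gammaSubgroup G 3 ≠ ⊥)
    (h81 : (gammaSubgroup G 4).index = 3 ^ 4) : IsOfMaximalClass 3 G := by
  have hne := commutator_ne_bot_of_gammaSubgroup_three_ne_bot h3
  have hcube := pow_mem_commutator hab hne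
  have h43 : (gammaSubgroup G 4).relIndex (gammaSubgroup G 3) = 3 := by
    have h := relIndex_mul_index (gammaSubgroup_antitone (G := G) (Nat.le_succ 3))
    rw [index_gammaSubgroup_three hab hne, h81, pow_succ'] at h
    exact Nat.eq_of_mul_eq_mul_right (by simp) h
  refine isOfMaximalClass_of_relIndex_dvd hab hne fun n => ?_
  by_cases h4 : gammaSubgroup G 4 = ⊥
  · match n with
    | 0 => exact (relIndex_gammaSubgroup_three_two hab hne).dvd
    | 1 => exact h43.dvd
    | n + 2 =>
      have hbot : gammaSubgroup G (n + 4) = ⊥ :=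
        le_bot_iff.mp (h4 ▸ gammaSubgroup_antitone (Nat.le_add_left 4 n))
      rw [hbot, relIndex_bot_right]
      exact one_dvd 3
  · obtain ⟨a, s, has, h2⟩ :=
      exists_closure_pair_gammaSubgroup_two_le_centralizerMod hab hne h43
    have hs := pow_three_mem_gammaSubgroup_four hab h43 h4 has h2
    exact relIndex_dvd_of_le_zpowers_sup
      (pow_mem_gammaSubgroup_succ hcube (engelCommutator_mem_gammaSubgroup s a (n + 1)))
      (gammaSubgroup_le_zpowers_engelCommutator_sup hs hcube has h2 n)

end MaximalClass

theorem proposition5_general {G : Type*} [Group G] [Finite G] [Group.IsNilpotent G]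
    (hab : (commutator G).index = 9) (hcard : 81 ≤ Nat.card G) :
    (powerSubgroup G 3 = gammaSubgroup G 3 ∧ (gammaSubgroup G 3).index = 27) ∧
    (∀ H : Subgroup G, IsCoatom H → Group.rank H ≤ 3) ∧
    (∃ H : Subgroup G, IsCoatom H ∧ (commutator H).index ≤ 27) ∧
    ((gammaSubgroup G 4).index = 3 ^ 4 → IsOfMaximalClass 3 G) := by
  have hne : commutator G ≠ ⊥ := by
    intro h
    rw [h, index_bot] at hab
    lia
  have hindex : (gammaSubgroup G 3).index = 27 := index_gammaSubgroup_three (p := 3) hab hne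
  have h3 : gammaSubgroup G 3 ≠ ⊥ := by
    intro h
    rw [h, index_bot] at hindex
    lia
  exact ⟨⟨powerSubgroup_three_eq_gammaSubgroup_three hab h3, hindex⟩,
    fun _ hH => rank_le_of_isCoatom (p := 3) hab hne hH,
    exists_isCoatom_index_commutator_le hab h3,
    isOfMaximalClass_of_index_gammaSubgroup_four hab h3⟩

theorem proposition5 {G : Type*} [Group G] [Finite G] (hG : IsPGroup 3 G)
    (hab : (commutator G).index = 9) (hcard : 81 ≤ Nat.card G) :
    (powerSubgroup G 3 = gammaSubgroup G 3 ∧ (gammaSubgroup G 3).index = 27) ∧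
    (∀ H : Subgroup G, IsCoatom H → Group.rank H ≤ 3) ∧
    ((∃ H : Subgroup G, IsCoatom H ∧ IsMetacyclic H) ∨
      (∃ H : Subgroup G, IsCoatom H ∧ (commutator H).index ≤ 27)) ∧
    ((gammaSubgroup G 4).index = 3 ^ 4 → IsOfMaximalClass 3 G) := by
  have := hG.isNilpotent
  obtain ⟨hpow, hrank, hcomm, hmax⟩ := proposition5_general hab hcard
  exact ⟨hpow, hrank, Or.inr hcomm, hmax⟩
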